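/- Let $n\ge 1$ and let $G$ be a finite undirected loopless multigraph on $[n]=\{1,\dots,n\}$ with $u_{ij}=u_{ji}$ edges between $i$ and $j$. Assume that $G$ is saturated: $u_{ij}\ge 1$ for all $i\ne j$ (and $u_{ii}=0$). Let $\mathbb K$ be a field, $S=\mathbb K[x_1,\dots,x_n]$, let $\Lambda_G$ be the Laplacian matrix of $G$ (diagonal entries $\sum_j u_{ij}$, off-diagonal entries $-u_{ij}$), $L=\operatorname{image}_{\mathbb Z}(\Lambda_G)\subset\mathbb Z^n$, and let $$I_G=\langle x^a-x^b : a,b\in\mathbb N^n,\ a-b\in L\rangle$$ be the toppling ideal. For disjoint $I,J\subseteq[n]$ put $x^{I\to J}=\prod_{i\in I}x_i^{\sum_{k\in J}u_{ik}}$. A split is an unordered pair $\{I,J\}$ of non-empty disjoint sets with $I\cup J=[n]$; its binomial is $x^{I\to J}-x^{J\to I}$ (well-defined up to sign). Let $\mathrm{Cyc}_{n,r}$ be the set of ordered partitions $(I_1,\dots,I_r)$ of $[n]$ into $r$ non-empty blocks, modulo cyclic rotation of the blocks. Let $\mathcal{CYC}_G$ be the sequence of free $S$-modules $0\leftarrow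 S^{\mathrm{Cyc}_{n,1}}\leftarrow S^{\mathrm{Cyc}_{n,2}}\leftarrow\cdots\leftarrow S^{\mathrm{Cyc}_{n,n}}\leftarrow 0$, where, for the representative with $n\in I_r$, $$(I_1,\dots,I_r)\mapsto\sum_{s=1}^{r-1}(-1)^{s-1}x^{I_s\to I_{s+1}}(I_1,\dots,I_s\cup I_{s+1},\dots,I_r)-x^{I_r\to I_1}(I_2,\dots,I_{r-1},I_1\cup I_r).$$ The (algebraic) Scarf complex of $L$ is defined as follows. A fiber is a set of all monomials $x^a$, $a\in\mathbb N^n$, in one congruence class modulo $L$. A finite fiber $C$ is basic if $\gcd(C)=1$ and $\gcd(C\setminus\{m\})\ne1$ for all $m\in C$ (where $\gcd(\emptyset)$ counts as $\neq 1$). The module in homological degree $k$ is free on the basic fibers with $k+1$ elements, and the differential sends $C$ to $\sum_{m\in C}(-1)^{p(m,C)}\gcd(C\setminus\{m\})\,C_m$, where $C_m=(C\setminus\{m\})/\gcd(C\setminus\{m\})$ and $p(m,C)$ is the number of elements of $C$ that are smaller than $m$ in a fixed monomial order. Then the following hold. 1. $I_G$ is a generic lattice ideal in the sense of Peeva and Sturmfels: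 it is the lattice ideal of a lattice containing no non-zero non-negative vector, and it is generated by binomials $x^a-x^b$ such that no coordinate of $a-b$ is zero. 2. There are exactly $2^{n-1}-1$ splits. Choose the sign of the binomial of each split arbitrarily. Then the binomials of distinct splits are distinct, they generate $I_G$, and no proper subset of them generates $I_G$. 3. These binomials form a Gröbner basis of $I_G$ for the (degree) reverse lexicographic order given by any ordering of the variables. 4. $\mathcal{CYC}_G$ coincides with the Scarf complex of $L$: there are bijections from $\mathrm{Cyc}_{n,k+1}$ to the set of basic fibers with $k+1$ elements, $k\ge0$, such that for every monomial order used to fix the signs in the Scarf complex, these bijections, together with suitable signs $\pm1$ of the basis elements (equal to $1$ in homological degree $0$), carry the differential of $\mathcal{CYC}_G$ to that of the Scarf complex. 5. $\mathcal{CYC}_G$ is a minimal free resolution of $S/I_G$, graded by $\mathbb Z^n/L$: with the augmentation $S^{\mathrm{Cyc}_{n,1}}\cong S\to S/I_G$ it is exact, its differentials are homogeneous of degree $0$ for suitable degrees of the basis elements (degree $0$ in homological degree $0$), and all entries of the differentials lie in $\langle x_1,\dots,x_n\rangle$. -/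

import Mathlib

open MvPolynomial

namespace ChipFiring

noncomputable section

/-! ### Multigraphs, the Laplacian lattice and the toppling ideal -/

/-- A finite undirected multigraph without loops on the `n + 1` nodes `0, 1, …, n`:
`mult i j` is the number of edges between the nodes `i` and `j`. -/
structure Multigraph (n : ℕ) where
  mult : Fin (n + 1) → Fin (n + 1) → ℕ
  symm : ∀ i j, mult i j = mult j i
  loopless : ∀ i, mult i i = 0

/-- Any two distinct nodes are joined by at least one edge. -/
def Multigraph.IsSaturated {n : ℕ} (G : Multigraph n) : Prop :=
  ∀ i j, i ≠ j → 0 < G.mult i j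

/-- The Laplacian matrix: node degrees on the diagonal, `-mult i j` off the diagonal. -/
def Multigraph.laplacian {n : ℕ} (G : Multigraph n) :
    Matrix (Fin (n + 1)) (Fin (n + 1)) ℤ :=
  Matrix.diagonal (fun i => ∑ j, (G.mult i j : ℤ)) - Matrix.of (fun i j => (G.mult i j : ℤ))

/-- The Laplacian lattice: the image over `ℤ` of the Laplacian matrix. -/
def Multigraph.lattice {n : ℕ} (G : Multigraph n) : Submodule ℤ (Fin (n + 1) → ℤ) :=
  LinearMap.range G.laplacian.mulVecLin

section Lattice

variable {σ : Type*}

/-- The exponent vectors `a` and `b` are congruent modulo the lattice `L`. -/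
def LatticeCongr (L : Submodule ℤ (σ → ℤ)) (a b : σ →₀ ℕ) : Prop :=
  (fun i => (a i : ℤ) - (b i : ℤ)) ∈ L

/-- The lattice ideal `I_L`, generated by all `x^a - x^b` with `a - b ∈ L`. -/
def latticeIdeal (K : Type*) [Field K] (L : Submodule ℤ (σ → ℤ)) :
    Ideal (MvPolynomial σ K) :=
  Ideal.span {f | ∃ a b : σ →₀ ℕ, LatticeCongr L a b ∧ f = monomial a 1 - monomial b 1}

/-- Generic lattice ideals in the sense of Peeva and Sturmfels: `I` is the lattice ideal of a
lattice `L` that contains no non-zero non-negative vector, and `I` is generated by binomials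
`x^a - x^b` such that no coordinate of `a - b` vanishes. -/
def IsGenericLatticeIdeal {K : Type*} [Field K] (I : Ideal (MvPolynomial σ K)) : Prop :=
  ∃ L : Submodule ℤ (σ → ℤ), (∀ v ∈ L, 0 ≤ v → v = 0) ∧ I = latticeIdeal K L ∧
    ∃ S : Set ((σ →₀ ℕ) × (σ →₀ ℕ)), (∀ p ∈ S, ∀ i, p.1 i ≠ p.2 i) ∧
      I = Ideal.span ((fun p => monomial p.1 (1 : K) - monomial p.2 1) '' S)

end Lattice

/-- The toppling ideal `I_G`: the lattice ideal of the Laplacian lattice. -/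
def Multigraph.topplingIdeal {n : ℕ} (K : Type*) [Field K] (G : Multigraph n) :
    Ideal (MvPolynomial (Fin (n + 1)) K) :=
  latticeIdeal K G.lattice

/-! ### Splits and their binomials -/

/-- The monomial `x^{I → J} = ∏_{i ∈ I} x_i ^ (∑_{k ∈ J} u_{ik})`. -/
def Multigraph.arrow {n : ℕ} (K : Type*) [Field K] (G : Multigraph n)
    (I J : Finset (Fin (n + 1))) : MvPolynomial (Fin (n + 1)) K :=
  ∏ i ∈ I, X i ^ (∑ k ∈ J, G.mult i k)

/-- `I` and `J` are non-empty, disjoint, and cover the set of nodes. -/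
def IsSplit {n : ℕ} (I J : Finset (Fin (n + 1))) : Prop :=
  I.Nonempty ∧ J.Nonempty ∧ Disjoint I J ∧ I ∪ J = Finset.univ

/-- Splits: unordered pairs `{I, J}` of non-empty disjoint sets with union the set of nodes. -/
def splits (n : ℕ) : Set (Sym2 (Finset (Fin (n + 1)))) :=
  {s | ∃ I J, IsSplit I J ∧ s = s(I, J)}

/-- `B` assigns to every split `{I, J}` the binomial `x^{I → J} - x^{J → I}`, which is
well-defined up to sign (either sign may be chosen, for each split separately). -/
def Multigraph.IsSplitBinomials {n : ℕ} {K : Type*} [Field K] (G : Multigraph n)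
    (B : splits n → MvPolynomial (Fin (n + 1)) K) : Prop :=
  ∀ s, ∃ I J, IsSplit I J ∧ s.1 = s(I, J) ∧ B s = G.arrow K I J - G.arrow K J I

/-- `S` generates `I`, and no proper subset of `S` does. -/
def IsMinimalGeneratingSet {R : Type*} [CommRing R] (S : Set R) (I : Ideal R) : Prop :=
  Ideal.span S = I ∧ ∀ T, T ⊂ S → Ideal.span T ≠ I

/-! ### Reverse lexicographic Gröbner bases -/

/-- A copy of the monoid of exponent vectors, to be ordered by the (degree) reverse lexicographic
order with `x_{π 0} > x_{π 1} > ⋯ > x_{π n}`. -/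
def RevLex {n : ℕ} (_π : Equiv.Perm (Fin (n + 1))) : Type := Fin (n + 1) →₀ ℕ

instance {n : ℕ} (π : Equiv.Perm (Fin (n + 1))) : AddCommMonoid (RevLex π) :=
  inferInstanceAs (AddCommMonoid (Fin (n + 1) →₀ ℕ))

/-- First compare total degrees, then the exponents of `x_{π n}, …, x_{π 0}` in this order, where
the larger exponent makes the smaller monomial. -/
def RevLex.key {n : ℕ} (π : Equiv.Perm (Fin (n + 1))) (a : Fin (n + 1) →₀ ℕ) :
    ℕ ×ₗ Lex (Fin (n + 1) → ℕᵒᵈ) :=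
  toLex (a.degree, toLex fun j => OrderDual.toDual (a (π j.rev)))

theorem RevLex.key_injective {n : ℕ} (π : Equiv.Perm (Fin (n + 1))) :
    Function.Injective (RevLex.key π) := by
  intro a b h
  have h2 : (fun j => OrderDual.toDual (a (π (Fin.rev j))))
      = fun j => OrderDual.toDual (b (π (Fin.rev j))) := 
    congrArg (fun p : ℕ ×ₗ Lex (Fin (n + 1) → ℕᵒᵈ) => ofLex (ofLex p).2) h
  ext i
  have h3 := congrFun h2 (π.symm i).rev
  simpa using h3

theorem RevLex.key_lt_iff {n : ℕ} (π : Equiv.Perm (Fin (n + 1))) (a b : Fin (n + 1) →₀ ℕ) :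
    RevLex.key π a < RevLex.key π b ↔ a.degree < b.degree ∨ (a.degree = b.degree ∧
      ∃ j, (∀ i, j < i → a (π i) = b (π i)) ∧ b (π j) < a (π j)) := by
  rw [RevLex.key, RevLex.key, Prod.Lex.toLex_lt_toLex]
  refine or_congr Iff.rfl (and_congr Iff.rfl ?_)
  constructor
  · rintro ⟨j, h1, h2⟩
    refine ⟨j.rev, fun i hi => ?_, h2⟩
    have h3 := h1 i.rev (by simpa using Fin.rev_lt_rev.2 hi)
    simpa using h3
  · rintro ⟨j, h1, h2⟩
    refine ⟨j.rev, fun i hi => ?_, ?_⟩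
    · have h3 := h1 i.rev (by simpa using Fin.rev_lt_rev.2 hi)
      simpa using h3
    · simpa using h2

instance {n : ℕ} (π : Equiv.Perm (Fin (n + 1))) : LinearOrder (RevLex π) :=
  LinearOrder.lift' (RevLex.key π) (RevLex.key_injective π)

theorem RevLex.lt_iff {n : ℕ} {π : Equiv.Perm (Fin (n + 1))} (a b : RevLex π) :
    a < b ↔ RevLex.key π a < RevLex.key π b := Iff.rfl

theorem RevLex.le_iff {n : ℕ} {π : Equiv.Perm (Fin (n + 1))} (a b : RevLex π) :
    a ≤ b ↔ RevLex.key π a ≤ RevLex.key π b := Iff.rfl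

theorem RevLex.key_add {n : ℕ} (π : Equiv.Perm (Fin (n + 1))) (a b : Fin (n + 1) →₀ ℕ) :
    RevLex.key π (a + b) = RevLex.key π a + RevLex.key π b := by
  unfold RevLex.key
  rw [map_add]
  rfl

instance {n : ℕ} (π : Equiv.Perm (Fin (n + 1))) : IsOrderedAddMonoid (RevLex π) where
  add_le_add_left a b h c := by
    rw [RevLex.le_iff] at h ⊢
    have e (x y : RevLex π) : RevLex.key π (x + y) = RevLex.key π x + RevLex.key π y :=
      RevLex.key_add π x y
    rw [e, e]
    exact add_le_add_left h _

instance {n : ℕ} (π : Equiv.Perm (Fin (n + 1))) : WellFoundedLT (RevLex π) := by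
  refine ⟨WellFounded.wellFounded_iff_has_min.2 fun s ⟨a, ha⟩ => ?_⟩
  have hfin : {b : Fin (n + 1) →₀ ℕ | b ∈ s ∧ b.degree ≤ Finsupp.degree (R := ℕ) a}.Finite :=
    (Finsupp.finite_of_degree_le (Finsupp.degree (R := ℕ) a)).subset fun b hb => hb.2
  obtain ⟨b, hb, hmin⟩ := Set.exists_min_image _ (RevLex.key π) hfin ⟨a, ha, le_rfl⟩
  refine ⟨b, hb.1, fun c hc hcb => ?_⟩
  replace hcb : RevLex.key π c < RevLex.key π b := hcb
  refine absurd (hmin c ⟨hc, ?_⟩) (not_le_of_gt hcb)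
  rcases (RevLex.key_lt_iff π _ _).1 hcb with h | h
  · exact h.le.trans hb.2
  · exact h.1.le.trans hb.2

/-- The reverse lexicographic term order with `x_{π 0} > x_{π 1} > ⋯ > x_{π n}`. -/
def revLex {n : ℕ} (π : Equiv.Perm (Fin (n + 1))) : MonomialOrder (Fin (n + 1)) where
  syn := RevLex π
  toSyn := { toEquiv := Equiv.refl (Fin (n + 1) →₀ ℕ), map_add' := fun _ _ => rfl }
  toSyn_monotone a b h := by
    show RevLex.key π a ≤ RevLex.key π b
    by_cases hab : a = b
    · rw [hab]
    · refine le_of_lt ((RevLex.key_lt_iff π a b).2 (Or.inl ?_))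
      obtain ⟨c, rfl⟩ := exists_add_of_le h
      rw [map_add]
      have hc : c ≠ 0 := fun h0 => hab (by rw [h0, add_zero])
      have h1 : c.degree ≠ 0 := fun h0 => hc ((Finsupp.degree_eq_zero_iff c).1 h0)
      omega

theorem revLex_lt_iff {n : ℕ} (π : Equiv.Perm (Fin (n + 1))) (a b : Fin (n + 1) →₀ ℕ) :
    (revLex π).toSyn a < (revLex π).toSyn b ↔ a.degree < b.degree ∨ (a.degree = b.degree ∧
      ∃ j, (∀ i, j < i → a (π i) = b (π i)) ∧ b (π j) < a (π j)) :=
  RevLex.key_lt_iff π a b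

/-- `S` is a Gröbner basis of `I`: it is contained in `I`, and the leading terms of the elements
of `S` generate the initial ideal of `I`. -/
def IsGroebnerBasis {σ K : Type*} [Field K] (ord : MonomialOrder σ)
    (S : Set (MvPolynomial σ K)) (I : Ideal (MvPolynomial σ K)) : Prop :=
  S ⊆ I ∧ Ideal.span (ord.leadingTerm '' S) = Ideal.span (ord.leadingTerm '' I)

/-! ### Cyclically ordered partitions and the complex `CYC_G` -/

/-- Ordered partitions `(I_0, …, I_k)` of the set of nodes into `k + 1` non-empty blocks, given by
the map that sends a node to the index of its block. -/
abbrev OrderedPartition (n k : ℕ) : Type :=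
  {f : Fin (n + 1) → Fin (k + 1) // Function.Surjective f}

/-- The block `I_s`. -/
def OrderedPartition.block {n k : ℕ} (f : OrderedPartition n k) (s : Fin (k + 1)) :
    Finset (Fin (n + 1)) :=
  Finset.univ.filter fun i => f.1 i = s

/-- Two ordered partitions are identified if they differ by a rotation of the block indices
(addition in `Fin (k + 1)` is modulo `k + 1`). -/
instance rotationSetoid (n k : ℕ) : Setoid (OrderedPartition n k) where
  r f g := ∃ c : Fin (k + 1), ∀ i, g.1 i = f.1 i + c
  iseqv :=
    { refl := fun f => ⟨0, fun i => by simp⟩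
      symm := fun {f g} ⟨c, h⟩ => ⟨-c, fun i => by rw [h]; abel⟩
      trans := fun {f g l} ⟨c, h⟩ ⟨d, h'⟩ => ⟨c + d, fun i => by rw [h', h]; abel⟩ }

/-- Cyclically ordered partitions of the set of `n + 1` nodes into `k + 1` blocks. -/
def Cyc (n k : ℕ) : Type := Quotient (rotationSetoid n k)

/-- The class of an ordered partition. -/
def Cyc.mk {n k : ℕ} (f : OrderedPartition n k) : Cyc n k := Quotient.mk _ f

/-- The rotation of an ordered partition for which the last node lies in the last block. -/
def OrderedPartition.normalize {n k : ℕ} (f : OrderedPartition n k) : OrderedPartition n k :=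
  ⟨fun i => f.1 i - f.1 (Fin.last n) - 1, fun j => by
    obtain ⟨i, hi⟩ := f.2 (j + 1 + f.1 (Fin.last n))
    exact ⟨i, by simp only [hi]; abel⟩⟩

/-- The unique representative of a cyclically ordered partition for which the last node lies in
the last block. -/
def Cyc.rep {n k : ℕ} : Cyc n k → OrderedPartition n k :=
  Quotient.lift OrderedPartition.normalize (by
    rintro f g ⟨c, h⟩
    apply Subtype.ext
    funext i
    simp only [OrderedPartition.normalize, h]
    abel)

theorem Cyc.mk_rep {n k : ℕ} (c : Cyc n k) : Cyc.mk c.rep = c := by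
  induction c using Quotient.inductionOn with
  | h f =>
    refine Quotient.sound ⟨f.1 (Fin.last n) + 1, fun i => ?_⟩
    show f.1 i = f.1 i - f.1 (Fin.last n) - 1 + (f.1 (Fin.last n) + 1)
    abel

theorem Cyc.rep_last {n k : ℕ} (c : Cyc n k) : c.rep.1 (Fin.last n) = Fin.last k := by
  induction c using Quotient.inductionOn with
  | h f =>
    show f.1 (Fin.last n) - f.1 (Fin.last n) - 1 = Fin.last k
    rw [sub_self, zero_sub, neg_eq_iff_add_eq_zero]
    exact (add_comm _ _).trans (Fin.last_add_one k)

theorem Cyc.isEmpty_of_lt {n k : ℕ} (h : n < k) : IsEmpty (Cyc n k) :=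
  ⟨fun c => by
    have h1 := Fintype.card_le_of_surjective _ c.rep.2
    simp only [Fintype.card_fin] at h1
    omega⟩

/-- `(I_0, …, I_s ∪ I_{s+1}, …, I_{k+1})`. -/
def OrderedPartition.merge {n k : ℕ} (f : OrderedPartition n (k + 1)) (s : Fin (k + 1)) :
    OrderedPartition n k :=
  ⟨fun i => s.predAbove (f.1 i), (Fin.predAbove_surjective s).comp f.2⟩

/-- `(I_1, …, I_k, I_0 ∪ I_{k+1})`. -/
def OrderedPartition.mergeEnds {n k : ℕ} (f : OrderedPartition n (k + 1)) :
    OrderedPartition n k :=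
  ⟨fun i => if h : f.1 i = 0 then Fin.last k else (f.1 i).pred h, fun j => by
    obtain ⟨i, hi⟩ := f.2 j.succ
    exact ⟨i, by simp [hi]⟩⟩

/-- The boundary map of `CYC_G` from cyclically ordered partitions with `k + 2` blocks to those
with `k + 1` blocks. On the representative `(I_0, …, I_{k+1})` with the last node in `I_{k+1}` it
is `∑_{s ≤ k} (-1)^s x^{I_s → I_{s+1}} (I_0, …, I_s ∪ I_{s+1}, …, I_{k+1})
- x^{I_{k+1} → I_0} (I_1, …, I_k, I_0 ∪ I_{k+1})`. -/
def Multigraph.cycBoundary {n : ℕ} (K : Type*) [Field K] (G : Multigraph n) (k : ℕ) :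
    (Cyc n (k + 1) →₀ MvPolynomial (Fin (n + 1)) K) →ₗ[MvPolynomial (Fin (n + 1)) K]
      (Cyc n k →₀ MvPolynomial (Fin (n + 1)) K) :=
  Finsupp.linearCombination _ fun c =>
    (∑ s : Fin (k + 1), Finsupp.single (Cyc.mk (c.rep.merge s))
      ((-1) ^ (s : ℕ) * G.arrow K (c.rep.block s.castSucc) (c.rep.block s.succ)))
    - Finsupp.single (Cyc.mk c.rep.mergeEnds)
      (G.arrow K (c.rep.block (Fin.last (k + 1))) (c.rep.block 0))

/-! ### Minimal free resolutions -/

/-- The free modules with bases `B 0, B 1, …` and the maps `d` form a minimal free resolution of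
`K[x]/I`, graded by `ℤ^σ / L`, with augmentation sending each element of `B 0` to `1`: the bases
are finite and eventually empty, the augmented sequence is exact, the maps are homogeneous of
degree `0` for suitable degrees of the basis elements, and all matrix entries of the maps lie in
the ideal generated by the variables. -/
structure IsMinimalFreeResolution {σ K : Type*} [Field K] (L : Submodule ℤ (σ → ℤ))
    (I : Ideal (MvPolynomial σ K)) (B : ℕ → Type*)
    (d : ∀ k, (B (k + 1) →₀ MvPolynomial σ K) →ₗ[MvPolynomial σ K] (B k →₀ MvPolynomial σ K)) :
    Prop where
  finite : ∀ k, Finite (B k)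
  bounded : ∃ N, ∀ k, N < k → IsEmpty (B k)
  surjective : Function.Surjective
    (Finsupp.linearCombination (MvPolynomial σ K) (fun _ : B 0 => (1 : MvPolynomial σ K ⧸ I)))
  exact_zero : Function.Exact (d 0)
    (Finsupp.linearCombination (MvPolynomial σ K) (fun _ : B 0 => (1 : MvPolynomial σ K ⧸ I)))
  exact_succ : ∀ k, Function.Exact (d (k + 1)) (d k)
  graded : ∃ deg : ∀ k, B k → (σ → ℤ) ⧸ L, (∀ b, deg 0 b = 0) ∧
    ∀ k b b', ∀ a ∈ (d k (Finsupp.single b 1) b').support,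
      deg (k + 1) b = L.mkQ (fun i => (a i : ℤ)) + deg k b'
  minimal : ∀ k b b', d k (Finsupp.single b 1) b' ∈ Ideal.span (Set.range X)

/-! ### The Scarf complex of a lattice -/

section Scarf

variable {σ : Type*} [Fintype σ]

/-- `C` is a fiber: the set of all monomials in one congruence class modulo `L`. -/
def IsFiber (L : Submodule ℤ (σ → ℤ)) (C : Finset (σ →₀ ℕ)) : Prop :=
  ∃ a, ∀ b, b ∈ C ↔ LatticeCongr L b a

/-- A fiber is basic if its monomials have greatest common divisor `1`, but after removing any one
of them the remaining ones have a non-trivial common divisor (which is regarded as true if none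
remains). -/
def IsBasicFiber (L : Submodule ℤ (σ → ℤ)) (C : Finset (σ →₀ ℕ)) : Prop :=
  IsFiber L C ∧ (∀ i, ∃ a ∈ C, a i = 0) ∧ ∀ m ∈ C, ∃ i, ∀ a ∈ C, a ≠ m → a i ≠ 0

/-- The basic fibers with `r` elements. -/
abbrev BasicFiber (L : Submodule ℤ (σ → ℤ)) (r : ℕ) : Type _ :=
  {C : Finset (σ →₀ ℕ) // IsBasicFiber L C ∧ C.card = r}

/-- The exponent vector of the greatest common divisor of a non-empty set of monomials. -/
def gcdExponent (C : Finset (σ →₀ ℕ)) : σ →₀ ℕ :=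
  Finsupp.equivFunOnFinite.symm fun i => sInf ((fun a : σ →₀ ℕ => a i) '' (C : Set (σ →₀ ℕ)))

open Classical in
/-- `C_m`: the set `C \ {m}` divided by its greatest common divisor. -/
def removeMonomial (C : Finset (σ →₀ ℕ)) (m : σ →₀ ℕ) : Finset (σ →₀ ℕ) :=
  (C.erase m).image fun a => a - gcdExponent (C.erase m)

theorem gcdExponent_le {C : Finset (σ →₀ ℕ)} {a : σ →₀ ℕ} (ha : a ∈ C) : gcdExponent C ≤ a :=
  fun _ => Nat.sInf_le ⟨a, ha, rfl⟩

theorem exists_eq_gcdExponent {C : Finset (σ →₀ ℕ)} (h : C.Nonempty) (i : σ) :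
    ∃ a ∈ C, a i = gcdExponent C i := by
  obtain ⟨a, ha⟩ := h
  have h1 : ((fun a : σ →₀ ℕ => a i) '' (C : Set (σ →₀ ℕ))).Nonempty := ⟨_, a, ha, rfl⟩
  obtain ⟨b, hb, hb'⟩ := Nat.sInf_mem h1
  exact ⟨b, hb, hb'⟩

theorem removeMonomial_isBasicFiber {L : Submodule ℤ (σ → ℤ)} {r : ℕ} {C : Finset (σ →₀ ℕ)}
    (hC : IsBasicFiber L C) (hr : C.card = r + 2) {m : σ →₀ ℕ} (hm : m ∈ C) :
    IsBasicFiber L (removeMonomial C m) ∧ (removeMonomial C m).card = r + 1 := by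
  classical
  obtain ⟨⟨a, ha⟩, hgcd, hbas⟩ := hC
  set E := C.erase m with hE
  set g := gcdExponent E with hg
  have hEcard : E.card = r + 1 := by rw [hE, Finset.card_erase_of_mem hm, hr]; rfl
  have hEne : E.Nonempty := Finset.card_pos.1 (by omega)
  have hle : ∀ b ∈ E, g ≤ b := fun b hb => gcdExponent_le hb
  have hmem : ∀ b, b ∈ removeMonomial C m ↔ b + g ∈ E := by
    intro b
    simp only [removeMonomial, Finset.mem_image]
    constructor
    · rintro ⟨c, hc, rfl⟩
      rwa [tsub_add_cancel_of_le (hle c hc)]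
    · intro h
      exact ⟨b + g, h, add_tsub_cancel_right b g⟩
  have hzero : ∀ p ∈ C, ∃ i, p i = 0 ∧ ∀ c ∈ C, c ≠ p → c i ≠ 0 := by
    intro p hp
    obtain ⟨i, hi⟩ := hbas p hp
    obtain ⟨c, hc, hc0⟩ := hgcd i
    by_cases hcp : c = p
    · exact ⟨i, hcp ▸ hc0, hi⟩
    · exact absurd hc0 (hi c hc hcp)
  obtain ⟨j, hmj, hj⟩ := hzero m hm
  have hgj : g j ≠ 0 := by
    obtain ⟨c, hc, hcj⟩ := exists_eq_gcdExponent hEne j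
    rw [hg, ← hcj]
    exact hj c (Finset.mem_of_mem_erase hc) (Finset.ne_of_mem_erase hc)
  refine ⟨⟨?_, ?_, ?_⟩, ?_⟩
  · obtain ⟨c, hc⟩ := hEne
    refine ⟨c - g, fun b => ?_⟩
    have hca := (ha c).1 (Finset.mem_of_mem_erase hc)
    have hiff : b + g ∈ C ↔ LatticeCongr L b (c - g) := by
      rw [ha]
      unfold LatticeCongr at hca ⊢
      rw [← L.sub_mem_iff_left hca]
      have : (fun i => (((b + g) i : ℕ) : ℤ) - (a i : ℤ)) - (fun i => (c i : ℤ) - (a i : ℤ))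
          = fun i => (b i : ℤ) - (((c - g) i : ℕ) : ℤ) := by
        funext i
        have h1 := hle c hc i
        simp only [Pi.sub_apply, Finsupp.add_apply, Finsupp.tsub_apply]
        omega
      rw [this]
    rw [hmem, ← hiff, hE, Finset.mem_erase]
    refine and_iff_right fun h => hgj ?_
    have h1 := congrArg (fun f : σ →₀ ℕ => f j) h
    simp only [Finsupp.add_apply, hmj] at h1
    omega
  · intro i
    obtain ⟨c, hc, hci⟩ := exists_eq_gcdExponent hEne i
    refine ⟨c - g, (hmem _).2 (by rwa [tsub_add_cancel_of_le (hle c hc)]), ?_⟩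
    rw [Finsupp.tsub_apply, hci, hg, Nat.sub_self]
  · intro p hp
    have hpE := (hmem p).1 hp
    obtain ⟨i, hpi, hi⟩ := hzero _ (Finset.mem_of_mem_erase hpE)
    have hgi : g i = 0 := by
      rw [Finsupp.add_apply] at hpi
      omega
    refine ⟨i, fun b hb hbp => ?_⟩
    have h1 := hi (b + g) (Finset.mem_of_mem_erase ((hmem b).1 hb))
      fun h => hbp (add_right_cancel h)
    rwa [Finsupp.add_apply, hgi, add_zero] at h1
  · rw [removeMonomial, Finset.card_image_of_injOn, hEcard]
    intro b hb c hc hbc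
    have h1 : b - g = c - g := hbc
    rw [← tsub_add_cancel_of_le (hle b hb), h1, tsub_add_cancel_of_le (hle c hc)]

/-- `C_m` as a basic fiber. -/
def BasicFiber.remove {L : Submodule ℤ (σ → ℤ)} {r : ℕ} (C : BasicFiber L (r + 2))
    (m : {m // m ∈ C.1}) : BasicFiber L (r + 1) :=
  ⟨removeMonomial C.1 m.1, removeMonomial_isBasicFiber C.2.1 C.2.2 m.2⟩

open Classical in
/-- The boundary map of the Scarf complex of `L`, whose module in homological degree `k` is free on
the basic fibers with `k + 1` elements. It sends `C` to
`∑_{m ∈ C} sign(m, C) · gcd(C \ {m}) · C_m`, where `sign(m, C) = (-1)^p` if exactly `p` elements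
of `C` are smaller than `m` in the monomial order `ord`. -/
def scarfBoundary (K : Type*) [Field K] (L : Submodule ℤ (σ → ℤ)) (ord : MonomialOrder σ) (k : ℕ) :
    (BasicFiber L (k + 2) →₀ MvPolynomial σ K) →ₗ[MvPolynomial σ K]
      (BasicFiber L (k + 1) →₀ MvPolynomial σ K) :=
  Finsupp.linearCombination _ fun C => ∑ m ∈ C.1.attach,
    Finsupp.single (C.remove m)
      ((-1) ^ (C.1.filter fun p => ord.toSyn p < ord.toSyn m.1).card *
        monomial (gcdExponent (C.1.erase m.1)) 1)

end Scarf

/-- The complex of free modules on `B` with maps `d` coincides with the complex of free modules on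
`B'` with maps `d'`: the bijections `e`, together with signs that are `1` in degree `0`, identify
the bases compatibly with the maps. -/
def CoincidesVia {R : Type*} [CommRing R] {B B' : ℕ → Type*} (e : ∀ k, B k ≃ B' k)
    (d : ∀ k, (B (k + 1) →₀ R) →ₗ[R] (B k →₀ R))
    (d' : ∀ k, (B' (k + 1) →₀ R) →ₗ[R] (B' k →₀ R)) : Prop :=
  ∃ ε : ∀ k, B k → ℤˣ, (∀ b, ε 0 b = 1) ∧ ∀ k b,
    d' k (Finsupp.single (e (k + 1) b) (((ε (k + 1) b : ℤˣ) : ℤ) : R)) =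
      Finsupp.linearCombination R
        (fun c => Finsupp.single (e k c) (((ε k c : ℤˣ) : ℤ) : R)) (d k (Finsupp.single b 1))

end

end ChipFiring

open ChipFiring

namespace ChipFiring

/-! ### Firing functions -/

/-! Two monomials are congruent when one arises from the other by chip-firing, `b = a - fire g`,
with `g` unique up to a constant. Saturation makes the discrete maximum principle strict: a node
where `g` is maximal loses chips unless `g` is constant. All rigidity below comes from this.

An ordered partition `t` yields the monomial `outflow t`, in which every node counts its edges to
later blocks. Firing the first `c` blocks rotates `t`, giving the monomials `state t c`. State `c`
vanishes exactly on the block cyclically before `c`, so each variable is missing from exactly one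
state; by the maximum principle (`exists_state_eq`) the states exhaust their fiber, which is
therefore basic. Conversely, two members of a basic fiber differ by firing a single set
(`IsBasicFiber.isFace`), the sets fired from a common source form a chain, and the steps of that
chain are the blocks of an ordered partition (`Multigraph.IsFace.exists_orderedPartition`). Omitting
one state merges two cyclically adjacent blocks and leaves the common factor `x^{I → J}`, so the two
differentials agree up to signs.

For exactness, the `K`-basis elements `x^a C` of the Scarf modules are read as finite sets of
monomials. These are precisely the non-empty sets whose members are pairwise related by `Reaches`,
so the Scarf complex is a simplicial chain complex. For the reverse lexicographic order the largest
vertex `v` of a face with at least two vertices is dominated by the monomial obtained from `v` by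
firing the largest legal set (`exists_largest_reaches`). Coning towards that monomial removes `v`
from a cycle, and well-founded descent shows that every cycle is a boundary
(`exists_simplexBoundary_eq`).

For the ideal, the key is `exists_split_le`: if `g` carries a monomial to a smaller one, then firing
just the set where `g` is maximal is already legal, so the leading monomial of a split binomial
divides it. This gives generation and the Gröbner bases. Minimality holds because no monomial `x^{I
→ J}` of a split divides that of another (`eq_of_arrowExp_le`). -/

section Firing

variable {n : ℕ} (G : Multigraph n)

/-- The chips that the nodes lose if every node `i` fires `g i` times. -/
def Multigraph.fire (g : Fin (n + 1) → ℤ) (i : Fin (n + 1)) : ℤ :=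
  ∑ j, (G.mult i j : ℤ) * (g i - g j)

/-- The indicator function of a decidable proposition. -/
def ind (p : Prop) [Decidable p] : ℤ := if p then 1 else 0

theorem ind_pos {p : Prop} [Decidable p] (h : p) : ind p = 1 := if_pos h

theorem ind_neg {p : Prop} [Decidable p] (h : ¬ p) : ind p = 0 := if_neg h

theorem ind_nonneg (p : Prop) [Decidable p] : 0 ≤ ind p := by
  unfold ind; split_ifs <;> simp

theorem laplacian_mulVec (g : Fin (n + 1) → ℤ) : G.laplacian.mulVec g = G.fire g := by
  funext i
  simp only [Multigraph.laplacian, Matrix.sub_mulVec, Matrix.mulVec_diagonal, Pi.sub_apply,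
    Multigraph.fire, mul_sub, Finset.sum_sub_distrib, Finset.sum_mul]
  rfl

theorem mem_lattice_iff {v : Fin (n + 1) → ℤ} : v ∈ G.lattice ↔ ∃ g, v = G.fire g := by
  simp only [Multigraph.lattice, LinearMap.mem_range, Matrix.mulVecLin_apply, laplacian_mulVec]
  exact ⟨fun ⟨g, h⟩ => ⟨g, h.symm⟩, fun ⟨g, h⟩ => ⟨g, h.symm⟩⟩

theorem latticeCongr_iff {a b : Fin (n + 1) →₀ ℕ} :
    LatticeCongr G.lattice a b ↔ ∃ g, ∀ i, (b i : ℤ) = a i - G.fire g i := by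
  unfold LatticeCongr
  rw [mem_lattice_iff]
  refine exists_congr fun g => ?_
  rw [funext_iff]
  exact forall_congr' fun i => by constructor <;> intro h <;> linarith

theorem fire_add (g h : Fin (n + 1) → ℤ) (i) :
    G.fire (fun j => g j + h j) i = G.fire g i + G.fire h i := by
  simp only [Multigraph.fire, ← Finset.sum_add_distrib]
  exact Finset.sum_congr rfl fun j _ => by ring

theorem fire_sub (g h : Fin (n + 1) → ℤ) (i) :
    G.fire (fun j => g j - h j) i = G.fire g i - G.fire h i := by
  simp only [Multigraph.fire, ← Finset.sum_sub_distrib]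
  exact Finset.sum_congr rfl fun j _ => by ring

theorem fire_const (c : ℤ) (i) : G.fire (fun _ => c) i = 0 := by
  simp [Multigraph.fire]

theorem fire_congr_of_sub_const {g h : Fin (n + 1) → ℤ} (c : ℤ) (hc : ∀ j, g j = h j + c) (i) :
    G.fire g i = G.fire h i := by
  rw [show g = fun j => h j + c from funext hc, fire_add G h (fun _ => c), fire_const, add_zero]

theorem sum_fire (g : Fin (n + 1) → ℤ) : ∑ i, G.fire g i = 0 := by
  have h : ∑ i, G.fire g i = -∑ i, G.fire g i := by
    conv_rhs => unfold Multigraph.fire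
    rw [Finset.sum_comm, ← Finset.sum_neg_distrib]
    refine Finset.sum_congr rfl fun i _ => ?_
    rw [Multigraph.fire, ← Finset.sum_neg_distrib]
    exact Finset.sum_congr rfl fun j _ => by rw [G.symm i j]; ring
  linarith

/-- The maximum principle: the loss at `i` depends monotonically on the differences between `i` and
the other nodes, strictly so in each of them because `i` is joined to every other node. -/
theorem fire_lt_of_lt {g h : Fin (n + 1) → ℤ} {i j : Fin (n + 1)} (hG : G.IsSaturated)
    (hle : ∀ k, g i - g k ≤ h i - h k) (hlt : g i - g j < h i - h j) : G.fire g i < G.fire h i := by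
  refine Finset.sum_lt_sum (fun k _ => mul_le_mul_of_nonneg_left (hle k) (by positivity))
    ⟨j, Finset.mem_univ _, mul_lt_mul_of_pos_left hlt ?_⟩
  exact_mod_cast hG i j (by rintro rfl; simp at hlt)

theorem fire_le_of_le {g h : Fin (n + 1) → ℤ} {i : Fin (n + 1)}
    (hle : ∀ k, g i - g k ≤ h i - h k) : G.fire g i ≤ G.fire h i :=
  Finset.sum_le_sum fun k _ => mul_le_mul_of_nonneg_left (hle k) (by positivity)

/-- A node where `g` is maximal would lose chips if any other value were smaller. Hence the
Laplacian kernel consists of constants, and firing functions can be compared after fixing their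
value at one node. -/
theorem eq_of_fire_eq_zero (hG : G.IsSaturated) {g : Fin (n + 1) → ℤ}
    (h : ∀ i, G.fire g i = 0) (i j : Fin (n + 1)) : g i = g j := by
  obtain ⟨m, -, hm⟩ := Finset.exists_max_image Finset.univ g ⟨0, Finset.mem_univ _⟩
  have key : ∀ j, g j = g m := by
    intro j
    by_contra hne
    have h1 := hm j (Finset.mem_univ _)
    have h2 : G.fire (fun _ => 0) m < G.fire g m :=
      fire_lt_of_lt G hG (j := j) (fun k => by have := hm k (Finset.mem_univ _); simpa using this)
        (by simpa using lt_of_le_of_ne h1 hne)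
    rw [fire_const, h m] at h2
    exact lt_irrefl _ h2
  rw [key i, key j]

theorem LatticeCongr.symm' {σ : Type*} {L : Submodule ℤ (σ → ℤ)} {a b : σ →₀ ℕ}
    (h : LatticeCongr L a b) : LatticeCongr L b a := by
  unfold LatticeCongr at *
  have := L.neg_mem h
  convert this using 1
  funext i
  simp

theorem LatticeCongr.trans' {σ : Type*} {L : Submodule ℤ (σ → ℤ)} {a b c : σ →₀ ℕ}
    (h : LatticeCongr L a b) (h' : LatticeCongr L b c) : LatticeCongr L a c := by
  unfold LatticeCongr at *
  have := L.add_mem h h'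
  convert this using 1
  funext i
  simp

theorem LatticeCongr.add_right {σ : Type*} {L : Submodule ℤ (σ → ℤ)} {a b : σ →₀ ℕ}
    (h : LatticeCongr L a b) (c : σ →₀ ℕ) : LatticeCongr L (a + c) (b + c) := by
  unfold LatticeCongr at *
  simpa using h

theorem degree_eq_of_latticeCongr {a b : Fin (n + 1) →₀ ℕ} (h : LatticeCongr G.lattice a b) :
    a.degree = b.degree := by
  obtain ⟨g, hg⟩ := (latticeCongr_iff G).1 h
  have h1 : ∑ i, (b i : ℤ) = ∑ i, (a i : ℤ) := by
    simp only [hg, Finset.sum_sub_distrib, sum_fire, sub_zero]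
  rw [Finsupp.degree_eq_sum, Finsupp.degree_eq_sum]
  exact_mod_cast h1.symm

end Firing

/-! ### The fiber of a cyclically ordered partition -/

section CyclicFiber

variable {n k : ℕ} (G : Multigraph n)

/-- The number of edges from each node to nodes of larger index `t`. -/
noncomputable def Multigraph.outflow (t : Fin (n + 1) → Fin (k + 1)) : Fin (n + 1) →₀ ℕ :=
  Finsupp.equivFunOnFinite.symm fun i => ∑ j, if t i < t j then G.mult i j else 0

/-- The outflow after a rotation of the indices. -/
noncomputable def Multigraph.state (t : Fin (n + 1) → Fin (k + 1)) (c : Fin (k + 1)) :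
    Fin (n + 1) →₀ ℕ :=
  G.outflow fun i => t i - c

theorem outflow_apply (t : Fin (n + 1) → Fin (k + 1)) (i) :
    (G.outflow t i : ℤ) = ∑ j, (G.mult i j : ℤ) * ind (t i < t j) := by
  simp [Multigraph.outflow, ind]

/-- Rotation changes the order indicator only by a difference of values of the indicator of `· < c`;
this is what makes a rotated outflow the result of firing the blocks before `c`. -/
theorem ind_sub_lt_sub (a b c : Fin (k + 1)) :
    ind (a - c < b - c) = ind (a < b) - ind (a < c) + ind (b < c) := by
  simp only [ind, Fin.lt_def, Fin.sub_def]
  have ha := a.2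
  have hb := b.2
  have hc := c.2
  have h1 : (k + 1 - c.1 + a.1) % (k + 1) = if a.1 < c.1 then k + 1 - c.1 + a.1 else a.1 - c.1 := by
    split_ifs with h
    · exact Nat.mod_eq_of_lt (by omega)
    · rw [show k + 1 - c.1 + a.1 = a.1 - c.1 + (k + 1) by omega, Nat.add_mod_right,
        Nat.mod_eq_of_lt (by omega)]
  have h2 : (k + 1 - c.1 + b.1) % (k + 1) = if b.1 < c.1 then k + 1 - c.1 + b.1 else b.1 - c.1 := by
    split_ifs with h
    · exact Nat.mod_eq_of_lt (by omega)
    · rw [show k + 1 - c.1 + b.1 = b.1 - c.1 + (k + 1) by omega, Nat.add_mod_right,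
        Nat.mod_eq_of_lt (by omega)]
  rw [h1, h2]
  split_ifs <;> omega

theorem state_apply (t : Fin (n + 1) → Fin (k + 1)) (c) (i) : (G.state t c i : ℤ) =
    ∑ j, (G.mult i j : ℤ) * (ind (t i < t j) - ind (t i < c) + ind (t j < c)) := by
  rw [Multigraph.state, outflow_apply]
  simp only [ind_sub_lt_sub]

theorem state_eq (t : Fin (n + 1) → Fin (k + 1)) (c) (i) : (G.state t c i : ℤ) =
    G.outflow t i - G.fire (fun j => ind (t j < c)) i := by
  rw [state_apply, outflow_apply, Multigraph.fire, ← Finset.sum_sub_distrib]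
  exact Finset.sum_congr rfl fun j _ => by ring

theorem state_zero (t : Fin (n + 1) → Fin (k + 1)) : G.state t 0 = G.outflow t := by
  simp [Multigraph.state]

theorem outflow_eq_zero_iff (hG : G.IsSaturated) (t : Fin (n + 1) → Fin (k + 1)) (i) :
    G.outflow t i = 0 ↔ ∀ j, t j ≤ t i := by
  simp only [Multigraph.outflow, Finsupp.equivFunOnFinite_symm_apply_apply,
    Finset.sum_eq_zero_iff, Finset.mem_univ, true_imp_iff]
  refine forall_congr' fun j => ?_
  constructor
  · intro h
    by_contra h1
    rw [if_pos (not_le.1 h1)] at h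
    exact (hG i j (by rintro rfl; simp at h1)).ne' h
  · intro h
    rw [if_neg (not_lt.2 h)]

/-- By saturation only the nodes of the final block have no outflow, and after rotating by `c` the
final block is the one with index `c - 1`, read cyclically. -/
theorem state_eq_zero_iff (hG : G.IsSaturated) (t : OrderedPartition n k) (c) (i) :
    G.state t.1 c i = 0 ↔ t.1 i + 1 = c := by
  rw [Multigraph.state, outflow_eq_zero_iff G hG]
  constructor
  · intro h
    obtain ⟨j, hj⟩ := t.2 (Fin.last k + c)
    have h1 := h j
    rw [hj, add_sub_cancel_right, Fin.last_le_iff, sub_eq_iff_eq_add] at h1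
    rw [h1, add_right_comm, Fin.last_add_one, zero_add]
  · rintro rfl j
    rw [show t.1 i - (t.1 i + 1) = Fin.last k from ?_]
    · exact Fin.le_last _
    · rw [sub_add_eq_sub_sub, sub_self, zero_sub, neg_eq_iff_add_eq_zero]
      exact (add_comm _ _).trans (Fin.last_add_one k)

theorem state_injective (hG : G.IsSaturated) (t : OrderedPartition n k) :
    Function.Injective (G.state t.1) := by
  intro c d h
  obtain ⟨i, hi⟩ := t.2 (c - 1)
  have h1 : t.1 i + 1 = c := by rw [hi, sub_add_cancel]
  have h2 := (state_eq_zero_iff G hG t c i).2 h1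
  rw [h] at h2
  exact h1.symm.trans ((state_eq_zero_iff G hG t d i).1 h2)

open Classical in
/-- The fiber of an ordered partition: the set of all rotated outflows. -/
noncomputable def Multigraph.cycFiber (t : Fin (n + 1) → Fin (k + 1)) :
    Finset (Fin (n + 1) →₀ ℕ) :=
  Finset.univ.image (G.state t)

theorem mem_cycFiber {t : Fin (n + 1) → Fin (k + 1)} {a} :
    a ∈ G.cycFiber t ↔ ∃ c, G.state t c = a := by
  simp [Multigraph.cycFiber]

theorem card_cycFiber (hG : G.IsSaturated) (t : OrderedPartition n k) :
    (G.cycFiber t.1).card = k + 1 := by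
  rw [Multigraph.cycFiber, Finset.card_image_of_injective _ (state_injective G hG t),
    Finset.card_univ, Fintype.card_fin]

theorem state_latticeCongr (t : Fin (n + 1) → Fin (k + 1)) (c) :
    LatticeCongr G.lattice (G.outflow t) (G.state t c) :=
  (latticeCongr_iff G).2 ⟨_, fun i => state_eq G t c i⟩

/-- The maximum principle with ties broken by `t`: a node that fires most often, and among these
lies in the latest block, can stay non-negative only if `g` is, up to a constant, the indicator of
an initial run of blocks. -/
theorem exists_state_eq (hG : G.IsSaturated) (t : OrderedPartition n k) {b : Fin (n + 1) →₀ ℕ}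
    (h : LatticeCongr G.lattice (G.outflow t.1) b) : ∃ c, G.state t.1 c = b := by
  obtain ⟨g, hg⟩ := (latticeCongr_iff G).1 h
  obtain ⟨i, -, hi⟩ := Finset.exists_max_image Finset.univ
    (fun i => toLex (g i, t.1 i)) ⟨0, Finset.mem_univ _⟩
  have hmax : ∀ j, g j < g i ∨ g j = g i ∧ t.1 j ≤ t.1 i := fun j =>
    (Prod.Lex.toLex_le_toLex.1 (hi j (Finset.mem_univ _)))
  -- These are the summands of `b i`. All are non-positive while `b i ≥ 0`, so saturation forces
  -- each to vanish, which determines `g`.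
  have hterm : ∀ j, ind (t.1 i < t.1 j) - (g i - g j) ≤ 0 := by
    intro j
    rcases hmax j with h1 | ⟨h1, h2⟩
    · unfold ind; split_ifs <;> omega
    · rw [ind_neg (not_lt.2 h2), h1]; simp
  have hgj : ∀ j, g j = g i - ind (t.1 i < t.1 j) := by
    intro j
    by_contra hne
    have hij : i ≠ j := by rintro rfl; simp [ind] at hne
    have h1 : (b i : ℤ) < 0 := by
      rw [hg, outflow_apply, Multigraph.fire, ← Finset.sum_sub_distrib]
      simp only [← mul_sub]
      refine Finset.sum_neg' (fun l _ => mul_nonpos_of_nonneg_of_nonpos (by positivity) (hterm l))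
        ⟨j, Finset.mem_univ _, mul_neg_of_pos_of_neg (by exact_mod_cast hG i j hij) ?_⟩
      have := hterm j
      omega
    omega
  refine ⟨t.1 i + 1, ?_⟩
  ext j
  have h1 : (G.state t.1 (t.1 i + 1) j : ℤ) = b j := by
    rw [state_eq, hg]
    congr 1
    -- If `i` is in the last block, then `t i + 1` wraps around to `0` and `g` is constant: nothing
    -- is fired.
    by_cases hl : t.1 i = Fin.last k
    · rw [hl, Fin.last_add_one]
      refine fire_congr_of_sub_const G (-g i) (fun j => ?_) j
      rw [hgj j, hl, ind_neg (not_lt.2 (Fin.le_last _)), ind_neg (Fin.not_lt_zero _)]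
      ring
    · refine fire_congr_of_sub_const G (1 - g i) (fun j => ?_) j
      rw [hgj j]
      have h2 : t.1 j < t.1 i + 1 ↔ ¬ t.1 i < t.1 j := by
        rw [not_lt, Fin.lt_def, Fin.le_def, Fin.val_add_one, if_neg hl]
        omega
      by_cases h3 : t.1 i < t.1 j
      · rw [ind_pos h3, ind_neg (by rw [h2]; exact not_not.2 h3)]; ring
      · rw [ind_neg h3, ind_pos (h2.2 h3)]; ring
  exact_mod_cast h1

theorem cycFiber_isBasicFiber (hG : G.IsSaturated) (t : OrderedPartition n k) :
    IsBasicFiber G.lattice (G.cycFiber t.1) := by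
  refine ⟨⟨G.outflow t.1, fun b => ?_⟩, fun i => ?_, fun m hm => ?_⟩
  · rw [mem_cycFiber]
    constructor
    · rintro ⟨c, rfl⟩
      exact (state_latticeCongr G t.1 c).symm'
    · exact fun h => exists_state_eq G hG t h.symm'
  · exact ⟨_, (mem_cycFiber G).2 ⟨t.1 i + 1, rfl⟩, (state_eq_zero_iff G hG t _ i).2 rfl⟩
  · obtain ⟨c, rfl⟩ := (mem_cycFiber G).1 hm
    obtain ⟨i, hi⟩ := t.2 (c - 1)
    refine ⟨i, fun a ha hne h0 => hne ?_⟩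
    obtain ⟨d, rfl⟩ := (mem_cycFiber G).1 ha
    rw [← (state_eq_zero_iff G hG t d i).1 h0, hi, sub_add_cancel]

end CyclicFiber

/-! ### Merging blocks -/

section Merge

variable {n k : ℕ} (G : Multigraph n)

/-- The exponent vector of `x^{I → J}`. -/
noncomputable def Multigraph.arrowExp (I J : Finset (Fin (n + 1))) : Fin (n + 1) →₀ ℕ :=
  Finsupp.equivFunOnFinite.symm fun i => if i ∈ I then ∑ k ∈ J, G.mult i k else 0

theorem arrowExp_apply (I J : Finset (Fin (n + 1))) (i) :
    G.arrowExp I J i = if i ∈ I then ∑ k ∈ J, G.mult i k else 0 := rfl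

theorem arrow_eq_monomial (K : Type*) [Field K] (I J : Finset (Fin (n + 1))) :
    G.arrow K I J = monomial (G.arrowExp I J) 1 := by
  rw [monomial_eq, C_1, one_mul, Finsupp.prod_fintype _ _ (fun _ => pow_zero _), Multigraph.arrow]
  simp only [arrowExp_apply, pow_ite, pow_zero, Finset.prod_ite_mem, Finset.univ_inter]

theorem arrowExp_block_apply (t : OrderedPartition n k) (s s') (i) :
    (G.arrowExp (t.block s) (t.block s') i : ℤ) =
      ∑ j, (G.mult i j : ℤ) * ind (t.1 i = s ∧ t.1 j = s') := by
  rw [arrowExp_apply]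
  simp only [OrderedPartition.block, Finset.mem_filter, Finset.mem_univ, true_and]
  by_cases h : t.1 i = s
  · simp [h, ind, Finset.sum_filter]
  · simp [h, ind]

theorem val_predAbove (s : Fin (k + 1)) (a : Fin (k + 2)) :
    (s.predAbove a).1 = if s.1 < a.1 then a.1 - 1 else a.1 := by
  by_cases h : s.1 < a.1
  · rw [if_pos h, Fin.predAbove_of_castSucc_lt _ _ (by simpa [Fin.lt_def] using h)]; simp
  · rw [if_neg h, Fin.predAbove_of_le_castSucc _ _ (by simpa [Fin.le_def] using h)]; simp

theorem val_succ_succAbove (s c : Fin (k + 1)) :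
    (s.succ.succAbove c).1 = if c.1 ≤ s.1 then c.1 else c.1 + 1 := by
  by_cases h : c.1 ≤ s.1
  · rw [if_pos h, Fin.succAbove_of_castSucc_lt _ _ (by simpa [Fin.lt_def, Nat.lt_succ_iff] using h)]
    simp
  · rw [if_neg h, Fin.succAbove_of_le_castSucc _ _ (by simp [Fin.le_def]; omega)]
    simp

theorem predAbove_lt_iff (s c : Fin (k + 1)) (a : Fin (k + 2)) :
    a < s.succ.succAbove c ↔ s.predAbove a < c := by
  simp only [Fin.lt_def, val_predAbove, val_succ_succAbove]
  split_ifs <;> omega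

theorem ind_lt_eq_predAbove (s : Fin (k + 1)) (a b : Fin (k + 2)) :
    ind (a < b) = ind (s.predAbove a < s.predAbove b) + ind (a = s.castSucc ∧ b = s.succ) := by
  simp only [ind, Fin.lt_def, Fin.ext_iff, val_predAbove, Fin.val_castSucc, Fin.val_succ]
  split_ifs <;> omega

/-- Only the state with index `s + 1` separates block `s` from block `s + 1`. The remaining states
survive the merge, and each loses the edges from `I_s` to `I_{s+1}`. -/
theorem state_merge (t : OrderedPartition n (k + 1)) (s c : Fin (k + 1)) :
    G.state t.1 (s.succ.succAbove c) =
      G.state (t.merge s).1 c + G.arrowExp (t.block s.castSucc) (t.block s.succ) := by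
  ext i
  refine Nat.cast_injective (R := ℤ) ?_
  rw [Finsupp.add_apply, Nat.cast_add, state_apply, state_apply, arrowExp_block_apply,
    ← Finset.sum_add_distrib]
  refine Finset.sum_congr rfl fun j _ => ?_
  rw [← mul_add]
  congr 1
  have h1 : ∀ a, ind (a < s.succ.succAbove c) = ind (s.predAbove a < c) := fun a => by
    simp only [ind, predAbove_lt_iff]
  rw [ind_lt_eq_predAbove s (t.1 i) (t.1 j), h1, h1, add_sub_right_comm,
    add_right_comm]
  rfl

/-- The cyclic counterpart: state `0` is the one omitted. In every other state the last block
precedes block `0`, so the edges between them form a common factor. -/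
theorem state_mergeEnds (t : OrderedPartition n (k + 1)) (c : Fin (k + 1)) :
    G.state t.1 c.succ = G.state t.mergeEnds.1 c +
      G.arrowExp (t.block (Fin.last (k + 1))) (t.block 0) := by
  have hval : ∀ i, (t.mergeEnds.1 i).1 = if (t.1 i).1 = 0 then k else (t.1 i).1 - 1 := by
    intro i
    simp only [OrderedPartition.mergeEnds]
    by_cases h : t.1 i = 0
    · rw [dif_pos h, if_pos (by rw [h]; rfl)]; rfl
    · rw [dif_neg h, if_neg (fun h0 => h (Fin.ext h0) : (t.1 i).1 ≠ 0)]; simp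
  ext i
  refine Nat.cast_injective (R := ℤ) ?_
  rw [Finsupp.add_apply, Nat.cast_add, state_apply, state_apply, arrowExp_block_apply,
    ← Finset.sum_add_distrib]
  refine Finset.sum_congr rfl fun j _ => ?_
  rw [← mul_add]
  congr 1
  simp only [ind, Fin.lt_def, Fin.ext_iff, hval, Fin.val_last, Fin.val_zero, Fin.val_succ]
  have h1 := (t.1 i).2
  have h2 := (t.1 j).2
  have h3 := c.2
  split_ifs <;> omega

theorem rep_mk {t : OrderedPartition n k} (h : t.1 (Fin.last n) = Fin.last k) :
    (Cyc.mk t).rep = t := by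
  apply Subtype.ext
  funext i
  show t.1 i - t.1 (Fin.last n) - 1 = t.1 i
  rw [h, sub_sub, Fin.last_add_one, sub_zero]

theorem merge_last {t : OrderedPartition n (k + 1)} (h : t.1 (Fin.last n) = Fin.last (k + 1))
    (s : Fin (k + 1)) : (t.merge s).1 (Fin.last n) = Fin.last k := by
  simp [OrderedPartition.merge, h]

theorem mergeEnds_last {t : OrderedPartition n (k + 1)}
    (h : t.1 (Fin.last n) = Fin.last (k + 1)) : t.mergeEnds.1 (Fin.last n) = Fin.last k := by
  simp only [OrderedPartition.mergeEnds, h]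
  rw [dif_neg (Fin.last_pos).ne', Fin.pred_last]

end Merge

/-! ### Basic fibers come from cyclically ordered partitions -/

section Faces

variable {n k : ℕ} (G : Multigraph n)

/-- Firing a set of nodes that does not contain the last node transforms `a` into `b`. -/
def Multigraph.Reaches (a b : Fin (n + 1) →₀ ℕ) : Prop :=
  ∃ U : Finset (Fin (n + 1)), Fin.last n ∉ U ∧ ∀ i, (b i : ℤ) = a i - G.fire (fun j => ind (j ∈ U)) i

/-- Sets of exponent vectors any two of which can be transformed into each other by firing
a set of nodes. -/
def Multigraph.IsFace (F : Finset (Fin (n + 1) →₀ ℕ)) : Prop :=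
  ∀ a ∈ F, ∀ b ∈ F, G.Reaches a b ∨ G.Reaches b a

theorem Multigraph.Reaches.latticeCongr {a b} (h : G.Reaches a b) : LatticeCongr G.lattice a b :=
  let ⟨_, _, h⟩ := h
  (latticeCongr_iff G).2 ⟨_, h⟩

/-- The last node never fires and, by saturation, receives a chip from every node that does. Its
coordinate thus orients `Reaches`. -/
theorem reaches_last (hG : G.IsSaturated) {a b} (h : G.Reaches a b) :
    a = b ∨ a (Fin.last n) < b (Fin.last n) := by
  obtain ⟨U, hU, h⟩ := h
  rcases U.eq_empty_or_nonempty with rfl | ⟨i, hi⟩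
  · left
    ext i
    have h1 := h i
    simp only [Finset.notMem_empty, ind, if_false, fire_const, sub_zero] at h1
    exact_mod_cast h1.symm
  · right
    have h1 : G.fire (fun j => ind (j ∈ U)) (Fin.last n) < G.fire (fun _ => 0) (Fin.last n) := by
      refine fire_lt_of_lt G hG (j := i) (fun j => ?_) ?_
      · rw [ind_neg hU]
        have := ind_nonneg (j ∈ U)
        omega
      · rw [ind_neg hU, ind_pos hi]; simp
    rw [fire_const] at h1
    have h2 := h (Fin.last n)
    omega

/-- If `Z` carries `b` to `c`, the indicator of `U` plus that of `Z` minus that of `W` lies in the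
Laplacian kernel and vanishes at the last node, so it is zero. -/
theorem reaches_trans_subset (hG : G.IsSaturated) {a b c : Fin (n + 1) →₀ ℕ}
    {U W : Finset (Fin (n + 1))} (hU : Fin.last n ∉ U) (hW : Fin.last n ∉ W)
    (hb : ∀ i, (b i : ℤ) = a i - G.fire (fun j => ind (j ∈ U)) i)
    (hc : ∀ i, (c i : ℤ) = a i - G.fire (fun j => ind (j ∈ W)) i) (h : G.Reaches b c) : U ⊆ W := by
  obtain ⟨Z, hZ, h⟩ := h
  have h1 : ∀ i, G.fire (fun j => ind (j ∈ U) + ind (j ∈ Z) - ind (j ∈ W)) i = 0 := by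
    intro i
    rw [fire_sub G (fun j => ind (j ∈ U) + ind (j ∈ Z)), fire_add]
    have := h i
    rw [hb, hc] at this
    linarith
  intro i hi
  have h2 := eq_of_fire_eq_zero G hG h1 i (Fin.last n)
  rw [ind_neg hU, ind_neg hW, ind_neg hZ, ind_pos hi] at h2
  by_contra h3
  rw [ind_neg h3] at h2
  have := ind_nonneg (i ∈ Z)
  omega

theorem Multigraph.IsFace.exists_source (hG : G.IsSaturated) {F : Finset (Fin (n + 1) →₀ ℕ)}
    (hF : G.IsFace F) (hne : F.Nonempty) : ∃ v ∈ F, ∀ b ∈ F, G.Reaches v b := by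
  obtain ⟨v, hv, hmin⟩ := Finset.exists_min_image F (fun a => a (Fin.last n)) hne
  refine ⟨v, hv, fun b hb => (hF v hv b hb).elim id fun h => ?_⟩
  rcases reaches_last G hG h with rfl | h1
  · exact h
  · exact absurd (hmin b hb) (not_le.2 h1)

/-- From a source `v` every member `b` is reached by firing a set `U b`; these sets form a chain
starting at the empty set, and the nodes are grouped by the step at which they enter it. -/
theorem Multigraph.IsFace.exists_orderedPartition (hG : G.IsSaturated) {F : Finset (Fin (n + 1) →₀ ℕ)}
    (hF : G.IsFace F) (hcard : F.card = k + 1) :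
    ∃ t : OrderedPartition n k, t.1 (Fin.last n) = Fin.last k ∧
      ∃ a, ∀ b, b ∈ F ↔ ∃ c, b = G.state t.1 c + a := by
  classical
  obtain ⟨v, hv, hvF⟩ := hF.exists_source G hG (Finset.card_pos.1 (by omega))
  choose! U hUq hU using hvF
  have hUv : U v = ∅ := by
    by_contra hne
    have h1 := reaches_trans_subset G hG (hUq v hv) (Finset.notMem_empty _) (hU v hv)
      (c := v) (fun i => by simp [ind, fire_const]) ⟨∅, by simp, fun i => by simp [ind, fire_const]⟩
    exact hne (Finset.subset_empty.1 h1)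
  have hinj : ∀ b ∈ F, ∀ b' ∈ F, U b = U b' → b = b' := by
    intro b hb b' hb' h
    ext i
    have h1 := hU b hb i
    rw [h, ← hU b' hb' i] at h1
    exact_mod_cast h1
  have hchain : ∀ b ∈ F, ∀ b' ∈ F, U b ⊆ U b' ∨ U b' ⊆ U b := fun b hb b' hb' =>
    (hF b hb b' hb').imp
      (reaches_trans_subset G hG (hUq b hb) (hUq b' hb') (hU b hb) (hU b' hb'))
      (reaches_trans_subset G hG (hUq b' hb') (hUq b hb) (hU b' hb') (hU b hb))
  -- `N i` counts the members of the chain that omit `i`, and `c b` below is the rank of `b` in the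
  -- chain. As the omitting members are the lowest ones, `i ∈ U b` exactly when `N i ≤ c b`; since
  -- `U v = ∅`, `N i - 1` is a genuine block index.
  set N : Fin (n + 1) → ℕ := fun i => (F.filter fun b => i ∉ U b).card with hN
  have hNpos : ∀ i, 0 < N i := fun i => Finset.card_pos.2 ⟨v, by simp [hv, hUv]⟩
  have hNle : ∀ i, N i ≤ k + 1 := fun i => hcard ▸ Finset.card_filter_le _ _
  set c : (Fin (n + 1) →₀ ℕ) → ℕ := fun b => (F.filter fun b' => U b' ⊂ U b).card with hc
  have hclt : ∀ b ∈ F, c b < k + 1 := fun b hb => hcard ▸ Finset.card_lt_card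
    (Finset.filter_ssubset.2 ⟨b, hb, fun h => h.ne rfl⟩)
  have hmem : ∀ b ∈ F, ∀ i, i ∈ U b ↔ N i - 1 < c b := by
    intro b hb i
    constructor
    · intro hi
      have : N i ≤ c b := Finset.card_le_card fun b' hb' => by
        rw [Finset.mem_filter] at hb' ⊢
        refine ⟨hb'.1, ?_⟩
        rcases hchain b' hb'.1 b hb with h | h
        · exact Finset.ssubset_iff_subset_ne.2 ⟨h, fun h => hb'.2 (h ▸ hi)⟩
        · exact absurd (h hi) hb'.2
      have := hNpos i
      omega
    · intro h
      by_contra hi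
      have : c b < N i := Finset.card_lt_card (Finset.ssubset_iff_of_subset (fun b' hb' => by
        rw [Finset.mem_filter] at hb' ⊢
        exact ⟨hb'.1, fun h => hi (hb'.2.subset h)⟩) |>.2
          ⟨b, Finset.mem_filter.2 ⟨hb, hi⟩, fun h => (Finset.mem_filter.1 h).2.ne rfl⟩)
      omega
  have hcinj : Set.InjOn c F := fun b hb b' hb' h => hinj b hb b' hb' (by
    ext i
    rw [hmem b hb, hmem b' hb', h])
  have hcsurj : ∀ s, s < k + 1 → ∃ b ∈ F, c b = s := by
    intro s hs
    have h1 : F.image c = Finset.range (k + 1) := by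
      refine Finset.eq_of_subset_of_card_le (fun s hs => ?_) ?_
      · obtain ⟨b, hb, rfl⟩ := Finset.mem_image.1 hs
        exact Finset.mem_range.2 (hclt b hb)
      · rw [Finset.card_image_of_injOn hcinj, hcard, Finset.card_range]
    exact Finset.mem_image.1 (h1 ▸ Finset.mem_range.2 hs)
  have hNlast : N (Fin.last n) = k + 1 := by
    rw [← hcard]
    exact congrArg Finset.card (Finset.filter_true_of_mem fun b hb => hUq b hb)
  -- An empty block would make two consecutive sets of the chain equal. The last block contains the
  -- last node, which lies in no `U b`.
  let t : OrderedPartition n k := ⟨fun i => ⟨N i - 1, by have := hNle i; omega⟩, fun s => by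
    by_cases hs : s.1 = k
    · exact ⟨Fin.last n, Fin.ext (by simp only [hNlast]; omega)⟩
    · obtain ⟨b, hb, hbs⟩ := hcsurj s.1 s.2
      obtain ⟨b', hb', hbs'⟩ := hcsurj (s.1 + 1) (by omega)
      by_contra hno
      have h1 : U b = U b' := by
        ext i
        rw [hmem b hb, hmem b' hb', hbs, hbs']
        have h2 : N i - 1 ≠ s.1 := fun h => hno ⟨i, Fin.ext h⟩
        omega
      rw [hinj b hb b' hb' h1] at hbs
      omega⟩
  have hfire : ∀ b ∈ F, ∀ s : Fin (k + 1), c b = s.1 →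
      ∀ i, (b i : ℤ) = v i - G.fire (fun j => ind (t.1 j < s)) i := by
    intro b hb s hs i
    rw [hU b hb]
    congr 2
    funext j
    simp only [ind, hmem b hb, hs]
    rfl
  -- At `i`, compare with the member of rank `t i + 1`: the corresponding state is zero there,
  -- whereas the member is non-negative.
  have hle : G.outflow t.1 ≤ v := by
    intro i
    obtain ⟨b, hb, hbs⟩ := hcsurj (t.1 i + 1 : Fin (k + 1)).1 (Fin.is_lt _)
    have h1 := hfire b hb _ hbs i
    have h2 := state_eq G t.1 (t.1 i + 1) i
    rw [(state_eq_zero_iff G hG t _ i).2 rfl] at h2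
    push_cast at h2
    omega
  have hstate : ∀ b ∈ F, ∀ s : Fin (k + 1), c b = s.1 →
      b = G.state t.1 s + (v - G.outflow t.1) := by
    intro b hb s hs
    ext i
    have h1 := hfire b hb s hs i
    have h2 := state_eq G t.1 s i
    have h3 := hle i
    rw [Finsupp.add_apply, Finsupp.tsub_apply]
    omega
  refine ⟨t, Fin.ext (by simp [t, hNlast]), v - G.outflow t.1, fun b => ⟨fun hb => ?_, ?_⟩⟩
  · exact ⟨⟨c b, hclt b hb⟩, hstate b hb _ rfl⟩
  · rintro ⟨s, rfl⟩
    obtain ⟨b, hb, hbs⟩ := hcsurj s.1 s.2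
    exact hstate b hb s hbs ▸ hb

/-- Firing only the positive part of `g` leads to a monomial `c` that at every node is at least the
smaller of `a` and `b`. In a basic fiber this forces `c = a` or `c = b`, so the positive or the
negative part of `g` is constant. -/
theorem IsBasicFiber.nonneg_or_nonpos (hG : G.IsSaturated) {C : Finset (Fin (n + 1) →₀ ℕ)}
    (hC : IsBasicFiber G.lattice C) {a b : Fin (n + 1) →₀ ℕ} (ha : a ∈ C) (hb : b ∈ C)
    {g : Fin (n + 1) → ℤ} (hg : ∀ i, (b i : ℤ) = a i - G.fire g i) :
    (∀ i, 0 ≤ g i) ∨ ∀ i, g i ≤ 0 := by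
  obtain ⟨⟨a₀, hfib⟩, hgcd, hbas⟩ := hC
  have hcases : ∀ i, (a i : ℤ) ≤ a i - G.fire (fun j => max 0 (g j)) i ∨
      (b i : ℤ) ≤ a i - G.fire (fun j => max 0 (g j)) i := by
    intro i
    rcases le_total (g i) 0 with h | h
    · left
      have : G.fire (fun j => max 0 (g j)) i ≤ G.fire (fun _ => 0) i :=
        fire_le_of_le G fun j => by have := le_max_left 0 (g j); simp only [max_eq_left h]; omega
      rw [fire_const] at this
      omega
    · right
      have : G.fire (fun j => max 0 (g j)) i ≤ G.fire g i :=
        fire_le_of_le G fun j => by have := le_max_right 0 (g j); simp only [max_eq_right h]; omega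
      rw [hg]
      omega
  let c : Fin (n + 1) →₀ ℕ := Finsupp.equivFunOnFinite.symm fun i =>
    ((a i : ℤ) - G.fire (fun j => max 0 (g j)) i).toNat
  have hc : ∀ i, (c i : ℤ) = a i - G.fire (fun j => max 0 (g j)) i := fun i =>
    Int.toNat_of_nonneg (by rcases hcases i with h | h <;> omega)
  have hcC : c ∈ C := (hfib c).2
    (((latticeCongr_iff G).2 ⟨_, hc⟩).symm'.trans' ((hfib a).1 ha))
  have hcab : c = a ∨ c = b := by
    by_contra! hne
    -- Basicness gives a variable missing from `c` alone, contrary to the lower bound for `c` in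
    -- terms of `a` and `b`.
    obtain ⟨i, hi⟩ := hbas c hcC
    obtain ⟨d, hd, hd0⟩ := hgcd i
    have hdc : d = c := by
      by_contra h
      exact hi d hd h hd0
    have h1 := hi a ha hne.1.symm
    have h2 := hi b hb hne.2.symm
    have h3 := hcases i
    rw [← hc, ← hdc, hd0] at h3
    omega
  rcases hcab with hca | hcb
  · have h1 := eq_of_fire_eq_zero G hG (g := fun j => max 0 (g j)) fun i => by
      have := hc i
      rw [hca] at this
      omega
    by_contra! hne
    obtain ⟨⟨i, hi⟩, j, hj⟩ := hne
    have := h1 i j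
    simp only [max_eq_left hi.le, max_eq_right hj.le] at this
    omega
  · have h1 := eq_of_fire_eq_zero G hG (g := fun j => g j - max 0 (g j)) fun i => by
      have := hc i
      rw [hcb] at this
      rw [fire_sub G g (fun j => max 0 (g j))]
      have := hg i
      omega
    by_contra! hne
    obtain ⟨⟨i, hi⟩, j, hj⟩ := hne
    have := h1 i j
    simp only [max_eq_left hi.le, max_eq_right hj.le] at this
    omega

theorem IsBasicFiber.isFace (hG : G.IsSaturated) {C : Finset (Fin (n + 1) →₀ ℕ)}
    (hC : IsBasicFiber G.lattice C) : G.IsFace C := by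
  intro a ha b hb
  have hab : LatticeCongr G.lattice a b := by
    obtain ⟨⟨a₀, h⟩, -⟩ := hC
    exact ((h a).1 ha).trans' ((h b).1 hb).symm'
  obtain ⟨g', hg'⟩ := (latticeCongr_iff G).1 hab
  obtain ⟨g, hgq, hg⟩ : ∃ g : Fin (n + 1) → ℤ, g (Fin.last n) = 0 ∧
      ∀ i, (b i : ℤ) = a i - G.fire g i :=
    ⟨fun i => g' i - g' (Fin.last n), sub_self _, fun i => by
      rw [hg', fire_sub G g' (fun _ => _), fire_const, sub_zero]⟩
  have hcomp : ∀ {g : Fin (n + 1) → ℤ}, (∀ i, (b i : ℤ) = a i - G.fire g i) →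
      (∀ i, 0 ≤ g i) ∨ ∀ i, g i ≤ 0 := fun h => hC.nonneg_or_nonpos G hG ha hb h
  rcases hcomp hg with h | h
  · left
    -- `g - 1` describes the same move and is negative at the last node, so it is non-positive
    -- everywhere: `g` takes only the values 0 and 1.
    have h1 : ∀ i, g i - 1 ≤ 0 := by
      refine (hcomp (g := fun i => g i - 1) fun i => ?_).resolve_left fun h1 => ?_
      · rw [hg, fire_sub G g (fun _ => 1), fire_const, sub_zero]
      · have := h1 (Fin.last n)
        omega
    refine ⟨Finset.univ.filter fun i => g i = 1, by simp [hgq], fun i => ?_⟩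
    rw [hg]
    congr 2
    funext j
    simp only [Finset.mem_filter, Finset.mem_univ, true_and, ind]
    have := h j
    have := h1 j
    split_ifs <;> omega
  · right
    have h1 : ∀ i, 0 ≤ g i + 1 := by
      refine (hcomp (g := fun i => g i + 1) fun i => ?_).resolve_right fun h1 => ?_
      · rw [hg, fire_add G g (fun _ => 1), fire_const, add_zero]
      · have := h1 (Fin.last n)
        omega
    refine ⟨Finset.univ.filter fun i => g i = -1, by simp [hgq], fun i => ?_⟩
    have h2 : G.fire (fun j => ind (j ∈ Finset.univ.filter fun i => g i = -1)) i = -G.fire g i := by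
      rw [eq_neg_iff_add_eq_zero, ← fire_add, ← fire_const G 0 i]
      congr 1
      funext j
      simp only [Finset.mem_filter, Finset.mem_univ, true_and, ind]
      have := h j
      have := h1 j
      split_ifs <;> omega
    rw [h2, hg]
    ring

end Faces

/-! ### Cyclically ordered partitions and basic fibers -/

section Bijection

variable {n k : ℕ} (G : Multigraph n)

/-- The basic fiber of a cyclically ordered partition. -/
noncomputable def Multigraph.cycBasicFiber (hG : G.IsSaturated) (c : Cyc n k) :
    BasicFiber G.lattice (k + 1) :=
  ⟨G.cycFiber c.rep.1, cycFiber_isBasicFiber G hG c.rep, card_cycFiber G hG c.rep⟩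

/-- Surjectivity leaves no gaps in the block indices, so they are determined by the strict order of
the nodes, from the lowest block upwards. -/
theorem eq_of_lt_imp_lt {t t' : OrderedPartition n k} (h : ∀ i j, t.1 i < t.1 j → t'.1 i < t'.1 j)
    (h' : ∀ i j, t'.1 i < t'.1 j → t.1 i < t.1 j) : t = t' := by
  have key : ∀ m : ℕ, ∀ i, (t.1 i).1 = m → t.1 i = t'.1 i := by
    intro m
    induction m using Nat.strong_induction_on with
    | _ m ih =>
      rintro i rfl
      rcases lt_trichotomy (t.1 i) (t'.1 i) with h1 | h1 | h1
      · obtain ⟨j, hj⟩ := t'.2 (t.1 i)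
        have h2 := h' j i (hj ▸ h1)
        have h3 := ih _ (Fin.lt_def.1 h2) j rfl
        rw [h3, hj] at h2
        exact absurd h2 (lt_irrefl _)
      · exact h1
      · obtain ⟨j, hj⟩ := t.2 (t'.1 i)
        rw [← hj] at h1
        have h3 := ih _ (Fin.lt_def.1 h1) j rfl
        have h4 := h j i h1
        rw [← h3, hj] at h4
        exact absurd h4 (lt_irrefl _)
  exact Subtype.ext (funext fun i => key _ i rfl)

theorem lt_imp_lt_of_cycFiber_eq (hG : G.IsSaturated) {t t' : OrderedPartition n k}
    (ht : t.1 (Fin.last n) = Fin.last k) (ht' : t'.1 (Fin.last n) = Fin.last k)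
    (h : G.cycFiber t.1 = G.cycFiber t'.1) (i j : Fin (n + 1)) (hij : t.1 i < t.1 j) :
    t'.1 i < t'.1 j := by
  have hmem : ∀ c, ∃ c', G.state t'.1 c' = G.state t.1 c := fun c =>
    (mem_cycFiber G).1 (h ▸ (mem_cycFiber G).2 ⟨c, rfl⟩)
  obtain ⟨c₀, hc₀⟩ := hmem 0
  -- State `0` is recognised inside the fiber as the only member that vanishes at the last node.
  have h0 : c₀ = 0 := by
    have h1 : G.state t.1 0 (Fin.last n) = 0 := by
      rw [state_eq_zero_iff G hG, ht, Fin.last_add_one]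
    rw [← hc₀, state_eq_zero_iff G hG, ht', Fin.last_add_one] at h1
    exact h1.symm
  rw [h0, state_zero, state_zero] at hc₀
  obtain ⟨c', hc'⟩ := hmem (t.1 j)
  -- Starting from the common state `0`, equal states come from equal fired sets, so `{t < t j}`
  -- equals `{t' < c'}`, which contains `i` but not `j`.
  have h1 := eq_of_fire_eq_zero G hG (g := fun l => ind (t.1 l < t.1 j) - ind (t'.1 l < c'))
    fun l => by
      rw [fire_sub G (fun l => ind (t.1 l < t.1 j)) (fun l => ind (t'.1 l < c'))]
      have h2 := state_eq G t.1 (t.1 j) l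
      rw [← hc', state_eq, hc₀] at h2
      linarith
  have h2 := h1 i (Fin.last n)
  have h3 := h1 j (Fin.last n)
  rw [ht, ht', ind_neg (not_lt.2 (Fin.le_last _)), ind_neg (not_lt.2 (Fin.le_last _))] at h2 h3
  rw [ind_pos hij] at h2
  rw [ind_neg (lt_irrefl _)] at h3
  refine lt_of_lt_of_le (?_ : t'.1 i < c') (?_ : c' ≤ t'.1 j)
  · by_contra h4
    rw [ind_neg h4] at h2
    omega
  · by_contra h4
    rw [ind_pos (not_le.1 h4)] at h3
    omega

theorem cycBasicFiber_bijective (hG : G.IsSaturated) :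
    Function.Bijective (G.cycBasicFiber hG : Cyc n k → BasicFiber G.lattice (k + 1)) := by
  constructor
  · intro c c' h
    have h1 : G.cycFiber c.rep.1 = G.cycFiber c'.rep.1 := congrArg Subtype.val h
    rw [← Cyc.mk_rep c, ← Cyc.mk_rep c', eq_of_lt_imp_lt
      (lt_imp_lt_of_cycFiber_eq G hG c.rep_last c'.rep_last h1)
      (lt_imp_lt_of_cycFiber_eq G hG c'.rep_last c.rep_last h1.symm)]
  · rintro ⟨C, hC, hcard⟩
    obtain ⟨t, ht, a, ha⟩ := (hC.isFace G hG).exists_orderedPartition G hG hcard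
    have ha0 : a = 0 := by
      ext i
      obtain ⟨m, hm, hmi⟩ := hC.2.1 i
      obtain ⟨c, rfl⟩ := (ha m).1 hm
      simp only [Finsupp.add_apply] at hmi
      rw [Finsupp.zero_apply]
      omega
    refine ⟨Cyc.mk t, Subtype.ext ?_⟩
    show G.cycFiber (Cyc.mk t).rep.1 = C
    rw [rep_mk ht]
    ext b
    rw [mem_cycFiber, ha, ha0]
    simp only [add_zero, eq_comm]

/-- The bijection between cyclically ordered partitions and basic fibers. -/
noncomputable def Multigraph.cycEquiv (hG : G.IsSaturated) (k : ℕ) :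
    Cyc n k ≃ BasicFiber G.lattice (k + 1) :=
  Equiv.ofBijective _ (cycBasicFiber_bijective G hG)

end Bijection

/-! ### Comparison of the boundary maps -/

section Removal

theorem gcdExponent_eq {σ : Type*} [Fintype σ] {E C : Finset (σ →₀ ℕ)} {g : σ →₀ ℕ}
    (hE : ∀ b, b ∈ E ↔ ∃ c ∈ C, b = c + g) (hC : ∀ i, ∃ a ∈ C, a i = 0) (hne : E.Nonempty) :
    gcdExponent E = g := by
  ext i
  obtain ⟨c, hc, hci⟩ := hC i
  have h1 := gcdExponent_le ((hE _).2 ⟨c, hc, rfl⟩) i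
  obtain ⟨b, hb, hbi⟩ := exists_eq_gcdExponent hne i
  obtain ⟨d, -, rfl⟩ := (hE b).1 hb
  simp only [Finsupp.add_apply] at h1 hbi
  omega

theorem removeMonomial_eq {σ : Type*} [Fintype σ] {C C' : Finset (σ →₀ ℕ)} {m g : σ →₀ ℕ}
    (h : ∀ b, b ∈ C ∧ b ≠ m ↔ ∃ c ∈ C', b = c + g) (hC : ∀ i, ∃ a ∈ C', a i = 0)
    (hne : C'.Nonempty) : removeMonomial C m = C' := by
  classical
  have hE : ∀ b, b ∈ C.erase m ↔ ∃ c ∈ C', b = c + g := fun b => by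
    rw [Finset.mem_erase, and_comm, h]
  have hg : gcdExponent (C.erase m) = g := gcdExponent_eq hE hC
    (hne.elim fun c hc => ⟨c + g, (hE _).2 ⟨c, hc, rfl⟩⟩)
  ext b
  rw [removeMonomial, Finset.mem_image]
  have hE' : ∀ b, b ∈ @Finset.erase _ (Classical.decEq _) C m ↔ b ∈ C.erase m := fun b => by
    simp only [Finset.mem_erase]
  constructor
  · rintro ⟨a, ha, rfl⟩
    obtain ⟨c, hc, rfl⟩ := (hE a).1 (by simpa [Finset.mem_erase] using ha)
    convert hc
    convert add_tsub_cancel_right c g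
  · intro hb
    refine ⟨b + g, by simpa [Finset.mem_erase] using (hE _).2 ⟨b, hb, rfl⟩, ?_⟩
    convert add_tsub_cancel_right b g

variable {n k : ℕ} (G : Multigraph n)

theorem mem_cycFiber_and_ne (hG : G.IsSaturated) (t : OrderedPartition n (k + 1))
    (t' : OrderedPartition n k) (j : Fin (k + 2)) (g : Fin (n + 1) →₀ ℕ)
    (h : ∀ c, G.state t.1 (j.succAbove c) = G.state t'.1 c + g) (b) :
    b ∈ G.cycFiber t.1 ∧ b ≠ G.state t.1 j ↔ ∃ c ∈ G.cycFiber t'.1, b = c + g := by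
  simp only [mem_cycFiber, exists_exists_eq_and, ← h]
  constructor
  · rintro ⟨⟨s, rfl⟩, hs⟩
    obtain ⟨c, rfl⟩ := Fin.exists_succAbove_eq (fun h' : s = j => hs (h' ▸ rfl))
    exact ⟨c, rfl⟩
  · rintro ⟨c, rfl⟩
    exact ⟨⟨_, rfl⟩, fun h' => Fin.succAbove_ne _ _ (state_injective G hG t h')⟩

theorem gcdExponent_erase_state [DecidableEq (Fin (n + 1) →₀ ℕ)] (hG : G.IsSaturated)
    (t : OrderedPartition n (k + 1))
    (t' : OrderedPartition n k) (j : Fin (k + 2)) (g : Fin (n + 1) →₀ ℕ)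
    (h : ∀ c, G.state t.1 (j.succAbove c) = G.state t'.1 c + g) :
    gcdExponent ((G.cycFiber t.1).erase (G.state t.1 j)) = g := by
  have hE := fun b => (mem_cycFiber_and_ne G hG t t' j g h b)
  refine gcdExponent_eq (C := G.cycFiber t'.1) (fun b => ?_) (cycFiber_isBasicFiber G hG t').2.1
    ⟨G.state t'.1 0 + g, ?_⟩
  · rw [Finset.mem_erase, and_comm, hE]
  · rw [Finset.mem_erase, and_comm, hE]
    exact ⟨_, (mem_cycFiber G).2 ⟨0, rfl⟩, rfl⟩

theorem remove_cycEquiv (hG : G.IsSaturated) (b : Cyc n (k + 1))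
    (t' : OrderedPartition n k) (j : Fin (k + 2)) (g : Fin (n + 1) →₀ ℕ)
    (h : ∀ c, G.state b.rep.1 (j.succAbove c) = G.state t'.1 c + g)
    (ht' : t'.1 (Fin.last n) = Fin.last k) (hm) :
    (G.cycEquiv hG (k + 1) b).remove ⟨G.state b.rep.1 j, hm⟩ = G.cycEquiv hG k (Cyc.mk t') := by
  refine Subtype.ext ?_
  show removeMonomial (G.cycFiber b.rep.1) (G.state b.rep.1 j) = G.cycFiber (Cyc.mk t').rep.1
  rw [rep_mk ht']
  exact removeMonomial_eq (mem_cycFiber_and_ne G hG b.rep t' j g h)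
    (cycFiber_isBasicFiber G hG t').2.1 ⟨_, (mem_cycFiber G).2 ⟨0, rfl⟩⟩

end Removal

/-! ### Signs of sorting permutations when an entry is deleted. -/

section Signs

/-- The sign of the permutation that sorts a finite sequence. -/
def sortSign {r : ℕ} {W : Type*} [LinearOrder W] (m : Fin r → W) : ℤˣ :=
  ∏ a, ∏ b, if a < b then (if m a < m b then 1 else -1) else 1

/-- Deleting entry `j` discards the pairs through `j`. Such a pair contributes `-1` exactly when
position and value compare differently with `j`, which is the product of the two indicator signs. -/
theorem sortSign_succAbove {r : ℕ} {W : Type*} [LinearOrder W] (m : Fin (r + 1) → W)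
    (hm : Function.Injective m) (j : Fin (r + 1)) :
    (-1) ^ (Finset.univ.filter fun a => m a < m j).card * sortSign m =
      (-1) ^ (j : ℕ) * sortSign (fun c => m (j.succAbove c)) := by
  have h1 : ((-1) ^ (Finset.univ.filter fun a => m a < m j).card : ℤˣ) =
      ∏ a, if m a < m j then -1 else 1 := by
    rw [Finset.prod_ite]; simp
  have h2 : ((-1) ^ (j : ℕ) : ℤˣ) = ∏ a, if a < j then -1 else 1 := by
    rw [Finset.prod_ite, ← Fin.card_Iio j]
    simp [Finset.filter_gt_eq_Iio]
  rw [h1, h2, sortSign, sortSign, Fin.prod_univ_succAbove _ j, Fin.prod_univ_succAbove _ j,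
    Fin.prod_univ_succAbove _ j, Fin.prod_univ_succAbove _ j]
  simp only [lt_irrefl, if_false, one_mul]
  simp only [Fin.prod_univ_succAbove _ j, Finset.prod_mul_distrib, Fin.succAbove_lt_succAbove_iff]
  rw [← mul_assoc, ← mul_assoc]
  congr 1
  rw [← Finset.prod_mul_distrib, ← Finset.prod_mul_distrib]
  refine Finset.prod_congr rfl fun c _ => ?_
  have h3 := Fin.succAbove_ne j c
  have h4 : m (j.succAbove c) ≠ m j := fun h => h3 (hm h)
  rcases lt_or_gt_of_ne h3 with h | h <;> rcases lt_or_gt_of_ne h4 with h' | h' <;>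
    simp [h, h', h.le.not_gt, h'.le.not_gt]

end Signs

/-! ### Term-by-term comparison of the cyclic complex with the Scarf complex. -/

section Comparison

variable {n : ℕ} (G : Multigraph n) (K : Type*) [Field K]

theorem card_filter_cycFiber {k : ℕ} (hG : G.IsSaturated) (ord : MonomialOrder (Fin (n + 1)))
    (t : OrderedPartition n k) (j : Fin (k + 1))
    [DecidablePred fun p => ord.toSyn p < ord.toSyn (G.state t.1 j)] :
    ((G.cycFiber t.1).filter fun p => ord.toSyn p < ord.toSyn (G.state t.1 j)).card =
      (Finset.univ.filter fun a => ord.toSyn (G.state t.1 a) < ord.toSyn (G.state t.1 j)).card := by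
  classical
  rw [← Finset.card_image_of_injective _ (state_injective G hG t)]
  congr 1
  ext b
  simp only [Finset.mem_filter, mem_cycFiber, Finset.mem_image, Finset.mem_univ, true_and]
  constructor
  · rintro ⟨⟨c, rfl⟩, h⟩
    exact ⟨c, h, rfl⟩
  · rintro ⟨c, h, rfl⟩
    exact ⟨⟨c, rfl⟩, h⟩

/-- The sign of the basis element of a cyclically ordered partition. -/
noncomputable def Multigraph.cycSign (ord : MonomialOrder (Fin (n + 1))) (k : ℕ) (c : Cyc n k) :
    ℤˣ :=
  (-1) ^ k * sortSign fun s => ord.toSyn (G.state c.rep.1 s)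

theorem cycSign_zero (ord : MonomialOrder (Fin (n + 1))) (c : Cyc n 0) :
    G.cycSign ord 0 c = 1 := by
  simp [Multigraph.cycSign, sortSign]

/-- Translation by `g` preserves the order of the states. The factor `(-1) ^ k` in `cycSign` shifts
the exponent from `j` to `j + 1`, as the cyclic differential requires: omitting state `s + 1` has
sign `(-1)^s` and omitting state `0` has sign `-1`. -/
theorem cycSign_face {k : ℕ} (hG : G.IsSaturated) (ord : MonomialOrder (Fin (n + 1)))
    (b : Cyc n (k + 1)) (t' : OrderedPartition n k) (j : Fin (k + 2)) (g : Fin (n + 1) →₀ ℕ)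
    (h : ∀ c, G.state b.rep.1 (j.succAbove c) = G.state t'.1 c + g)
    (ht' : t'.1 (Fin.last n) = Fin.last k) :
    (-1) ^ (Finset.univ.filter fun a =>
        ord.toSyn (G.state b.rep.1 a) < ord.toSyn (G.state b.rep.1 j)).card *
      G.cycSign ord (k + 1) b = (-1) ^ ((j : ℕ) + 1) * G.cycSign ord k (Cyc.mk t') := by
  have h1 := sortSign_succAbove (fun s => ord.toSyn (G.state b.rep.1 s))
    (fun x y hxy => state_injective G hG b.rep (ord.toSyn.injective hxy)) j
  have h2 : sortSign (fun c => ord.toSyn (G.state b.rep.1 (j.succAbove c))) =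
      sortSign (fun c => ord.toSyn (G.state t'.1 c)) := by
    simp only [sortSign, h, map_add, add_lt_add_iff_right]
  rw [h2] at h1
  rw [Multigraph.cycSign, Multigraph.cycSign, rep_mk ht', mul_left_comm, h1, pow_succ, pow_succ]
  have h3 : ∀ x y s : ℤˣ, x * -1 * (y * s) = y * -1 * (x * s) := fun x y s => by ac_rfl
  exact h3 _ _ _

theorem state_mem_cycEquiv {k : ℕ} (hG : G.IsSaturated) (b : Cyc n k) (j) :
    G.state b.rep.1 j ∈ (G.cycEquiv hG k b).1 :=
  (mem_cycFiber G).2 ⟨j, rfl⟩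

open Classical in
theorem scarfBoundary_cycEquiv {k : ℕ} (hG : G.IsSaturated) (ord : MonomialOrder (Fin (n + 1)))
    (b : Cyc n (k + 1)) (r : MvPolynomial (Fin (n + 1)) K) :
    scarfBoundary K G.lattice ord k (Finsupp.single (G.cycEquiv hG (k + 1) b) r) =
      ∑ j : Fin (k + 2), r •
        Finsupp.single ((G.cycEquiv hG (k + 1) b).remove ⟨_, state_mem_cycEquiv G hG b j⟩)
          ((-1) ^ ((G.cycEquiv hG (k + 1) b).1.filter fun p =>
            ord.toSyn p < ord.toSyn (G.state b.rep.1 j)).card *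
            monomial (gcdExponent
              ((G.cycEquiv hG (k + 1) b).1.erase (G.state b.rep.1 j))) (1 : K)) := by
  rw [scarfBoundary, Finsupp.linearCombination_single, Finset.smul_sum]
  symm
  refine Finset.sum_bij (fun j _ => ⟨_, state_mem_cycEquiv G hG b j⟩)
    (fun _ _ => Finset.mem_attach _ _)
    (fun j _ j' _ h => state_injective G hG b.rep (congrArg Subtype.val h)) ?_ ?_
  · rintro ⟨m, hm⟩ -
    obtain ⟨j, rfl⟩ := (mem_cycFiber G).1 hm
    exact ⟨j, Finset.mem_univ _, rfl⟩
  · intro j _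
    congr!

open Classical in
theorem scarfBoundary_term {k : ℕ} (hG : G.IsSaturated) (ord : MonomialOrder (Fin (n + 1)))
    (b : Cyc n (k + 1)) (t' : OrderedPartition n k) (j : Fin (k + 2)) (g : Fin (n + 1) →₀ ℕ)
    (h : ∀ c, G.state b.rep.1 (j.succAbove c) = G.state t'.1 c + g)
    (ht' : t'.1 (Fin.last n) = Fin.last k) :
    (((G.cycSign ord (k + 1) b : ℤˣ) : ℤ) : MvPolynomial (Fin (n + 1)) K) •
      Finsupp.single ((G.cycEquiv hG (k + 1) b).remove ⟨_, state_mem_cycEquiv G hG b j⟩)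
        ((-1) ^ ((G.cycEquiv hG (k + 1) b).1.filter fun p =>
          ord.toSyn p < ord.toSyn (G.state b.rep.1 j)).card *
          monomial (gcdExponent ((G.cycEquiv hG (k + 1) b).1.erase (G.state b.rep.1 j))) (1 : K)) =
    ((-1) ^ ((j : ℕ) + 1) * monomial g (1 : K)) • Finsupp.single (G.cycEquiv hG k (Cyc.mk t'))
      (((G.cycSign ord k (Cyc.mk t') : ℤˣ) : ℤ) : MvPolynomial (Fin (n + 1)) K) := by
  have h1 := congrArg (fun u : ℤˣ => (((u : ℤˣ) : ℤ) : MvPolynomial (Fin (n + 1)) K))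
    (cycSign_face G hG ord b t' j g h ht')
  have h2 : gcdExponent ((G.cycEquiv hG (k + 1) b).1.erase (G.state b.rep.1 j)) = g :=
    gcdExponent_erase_state G hG b.rep t' j g h
  have h3 : ((G.cycEquiv hG (k + 1) b).1.filter fun p =>
      ord.toSyn p < ord.toSyn (G.state b.rep.1 j)).card = _ :=
    card_filter_cycFiber G hG ord b.rep j
  simp only [Units.val_mul, Units.val_pow_eq_pow_val, Units.val_neg, Units.val_one,
    Int.cast_mul, Int.cast_pow, Int.cast_neg, Int.cast_one] at h1
  rw [remove_cycEquiv G hG b t' j g h ht', h2, h3, Finsupp.smul_single, Finsupp.smul_single,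
    smul_eq_mul, smul_eq_mul]
  congr 1
  linear_combination (monomial g (1 : K)) * h1

theorem coincidesVia (hG : G.IsSaturated) (ord : MonomialOrder.{0, 0} (Fin (n + 1))) :
    CoincidesVia (G.cycEquiv hG) (G.cycBoundary K) (scarfBoundary K G.lattice ord) := by
  classical
  refine ⟨G.cycSign ord, cycSign_zero G ord, fun k b => ?_⟩
  rw [scarfBoundary_cycEquiv, Fin.sum_univ_succ, scarfBoundary_term G K hG ord b b.rep.mergeEnds 0 _
    (fun c => by rw [Fin.zero_succAbove]; exact state_mergeEnds G b.rep c)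
    (mergeEnds_last b.rep_last)]
  rw [Finset.sum_congr rfl fun (s : Fin (k + 1)) _ => scarfBoundary_term G K hG ord b
    (b.rep.merge s) s.succ _ (state_merge G b.rep s) (merge_last b.rep_last s)]
  rw [Multigraph.cycBoundary, Finsupp.linearCombination_single, one_smul, map_sub, map_sum,
    Finsupp.linearCombination_single]
  simp only [Finsupp.linearCombination_single, arrow_eq_monomial]
  rw [sub_eq_add_neg, ← neg_smul]
  refine (add_comm _ _).trans (congrArg₂ _ (Finset.sum_congr rfl fun s _ => ?_) ?_)
  · rw [Fin.val_succ, pow_succ, pow_succ, mul_neg_one, mul_neg_one, neg_neg]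
  · rw [Fin.val_zero, zero_add, pow_one, neg_one_mul]

end Comparison

/-! ### Simplicial chains -/

section Simplicial

variable {K V W : Type*} [Field K] [LinearOrder W] (κ : V → W)

open Classical in
/-- The number of elements of `F` that are smaller than `m`. -/
noncomputable def position (F : Finset V) (m : V) : ℕ := (F.filter fun p => κ p < κ m).card

open Classical in
/-- The boundary map of the chain complex of the full simplex on `V`, with coefficients in `K`. -/
noncomputable def simplexBoundary (K : Type*) [Field K] : (Finset V →₀ K) →ₗ[K] (Finset V →₀ K) :=
  Finsupp.linearCombination K fun F =>
    ∑ m ∈ F, Finsupp.single (F.erase m) ((-1) ^ position κ F m)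

open Classical in
/-- The cone operator with apex `w`. -/
noncomputable def simplexCone (K : Type*) [Field K] (w : V) : (Finset V →₀ K) →ₗ[K] (Finset V →₀ K) :=
  Finsupp.linearCombination K fun F =>
    if w ∈ F then 0 else Finsupp.single (insert w F) ((-1) ^ position κ F w)

theorem simplexBoundary_single (F : Finset V) (r : K) [DecidableEq V] :
    simplexBoundary κ K (Finsupp.single F r) =
      r • ∑ m ∈ F, Finsupp.single (F.erase m) ((-1) ^ position κ F m) := by
  rw [simplexBoundary, Finsupp.linearCombination_single]
  congr!

theorem simplexCone_single (F : Finset V) (r : K) (w : V) [DecidableEq V] :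
    simplexCone κ K w (Finsupp.single F r) =
      r • if w ∈ F then 0 else Finsupp.single (insert w F) ((-1) ^ position κ F w) := by
  rw [simplexCone, Finsupp.linearCombination_single]
  congr!

theorem position_insert [DecidableEq V] {F : Finset V} {w : V} (hw : w ∉ F) (m : V) :
    position κ (insert w F) m = position κ F m + if κ w < κ m then 1 else 0 := by
  classical
  rw [position, position, Finset.filter_insert]
  split_ifs with h
  · rw [Finset.card_insert_of_notMem (by simp [hw])]
  · rfl

theorem position_erase [DecidableEq V] {F : Finset V} {m : V} (hm : m ∈ F) (w : V) :
    position κ F w = position κ (F.erase m) w + if κ m < κ w then 1 else 0 := by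
  conv_lhs => rw [← Finset.insert_erase hm]
  exact position_insert κ (Finset.notMem_erase m F) w

theorem neg_one_pow_mul_self (p : ℕ) : ((-1 : K) ^ p) * (-1) ^ p = 1 := by
  rw [← pow_add, ← two_mul, pow_mul]; simp

/-- The cone is a contracting homotopy of the full simplex. The complex is augmented, since single
vertices map to the empty face, so no correction term appears. -/
theorem simplexBoundary_cone (hκ : Function.Injective κ) (w : V) (z : Finset V →₀ K) :
    simplexBoundary κ K (simplexCone κ K w z) + simplexCone κ K w (simplexBoundary κ K z) = z := by
  classical
  suffices h : simplexBoundary κ K ∘ₗ simplexCone κ K w + simplexCone κ K w ∘ₗ simplexBoundary κ K =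
      LinearMap.id from LinearMap.congr_fun h z
  refine Finsupp.lhom_ext' fun F => LinearMap.ext_ring ?_
  simp only [LinearMap.comp_apply, LinearMap.add_apply, Finsupp.lsingle_apply, LinearMap.id_apply]
  rw [simplexBoundary_single, simplexCone_single, one_smul, one_smul, map_sum]
  simp only [simplexCone_single]
  by_cases hw : w ∈ F
  · rw [if_pos hw, map_zero, zero_add, Finset.sum_eq_single w]
    · rw [if_neg (Finset.notMem_erase w F), Finset.insert_erase hw, position_erase κ hw w,
        if_neg (lt_irrefl _), add_zero, Finsupp.smul_single, smul_eq_mul, neg_one_pow_mul_self]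
    · intro m hm hmw
      rw [if_pos (Finset.mem_erase.2 ⟨hmw.symm, hw⟩), smul_zero]
    · exact fun h => absurd hw h
  · rw [if_neg hw, simplexBoundary_single, Finset.sum_insert hw,
      Finset.erase_insert hw, position_insert κ hw, if_neg (lt_irrefl _), add_zero, smul_add,
      Finsupp.smul_single, smul_eq_mul, neg_one_pow_mul_self, add_assoc]
    refine add_eq_left.2 ?_
    rw [Finset.smul_sum, ← Finset.sum_add_distrib]
    refine Finset.sum_eq_zero fun m hm => ?_
    have hmw : w ≠ m := fun h => hw (h ▸ hm)
    rw [if_neg fun h => hw (Finset.mem_of_mem_erase h), Finset.erase_insert_of_ne hmw,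
      position_insert κ hw, position_erase κ hm w, Finsupp.smul_single, Finsupp.smul_single,
      smul_eq_mul, smul_eq_mul, ← Finsupp.single_add]
    rcases lt_or_gt_of_ne (fun h => hmw (hκ h) : κ w ≠ κ m) with h | h
    · rw [if_pos h, if_neg h.not_gt, pow_succ]
      simp [mul_comm]
    · rw [if_pos h, if_neg h.not_gt, pow_succ]
      simp [mul_comm]

/-- Adding one vertex at a time: two uses of the homotopy identity turn `∂∂` of a cone into the cone
of `∂∂`, and `insert w F` is the cone over `F` up to sign. -/
theorem simplexBoundary_simplexBoundary (hκ : Function.Injective κ) (z : Finset V →₀ K) :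
    simplexBoundary κ K (simplexBoundary κ K z) = 0 := by
  classical
  suffices h : simplexBoundary κ K ∘ₗ simplexBoundary κ K = 0 from LinearMap.congr_fun h z
  refine Finsupp.lhom_ext' fun F => LinearMap.ext_ring ?_
  simp only [LinearMap.comp_apply, Finsupp.lsingle_apply, LinearMap.zero_apply]
  induction F using Finset.induction_on with
  | empty => simp [simplexBoundary_single]
  | insert w F hw ih =>
    have h0 : simplexBoundary κ K (simplexBoundary κ K
        (simplexCone κ K w (Finsupp.single F (1 : K)))) = 0 := by
      rw [eq_sub_of_add_eq (simplexBoundary_cone κ hκ w (Finsupp.single F (1 : K))), map_sub,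
        eq_sub_of_add_eq (simplexBoundary_cone κ hκ w (simplexBoundary κ K (Finsupp.single F 1))),
        ih, map_zero]
      simp
    rw [simplexCone_single, if_neg hw, one_smul, ← mul_one ((-1 : K) ^ _), ← smul_eq_mul,
      ← Finsupp.smul_single, map_smul, map_smul] at h0
    exact (smul_eq_zero.1 h0).resolve_left (pow_ne_zero _ (by simp))

theorem mem_supported_mono {s t : Set (Finset V)} {z : Finset V →₀ K}
    (hz : z ∈ Finsupp.supported K K s) (h : ∀ F ∈ s, F ∈ t) : z ∈ Finsupp.supported K K t :=
  Finsupp.supported_mono h hz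

theorem simplexBoundary_mem_supported [DecidableEq V] {s t : Set (Finset V)}
    {z : Finset V →₀ K} (hz : z ∈ Finsupp.supported K K s) (h : ∀ F ∈ s, ∀ m ∈ F, F.erase m ∈ t) :
    simplexBoundary κ K z ∈ Finsupp.supported K K t := by
  rw [simplexBoundary, Finsupp.linearCombination_apply]
  refine Submodule.sum_mem _ fun F hF => Submodule.smul_mem _ _ (Submodule.sum_mem _ fun m hm => ?_)
  refine Finsupp.single_mem_supported K _ ?_
  convert h F (hz hF) m hm

theorem simplexCone_mem_supported [DecidableEq V] {s t : Set (Finset V)} {w : V}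
    {z : Finset V →₀ K} (hz : z ∈ Finsupp.supported K K s) (h : ∀ F ∈ s, w ∉ F → insert w F ∈ t) :
    simplexCone κ K w z ∈ Finsupp.supported K K t := by
  rw [simplexCone, Finsupp.linearCombination_apply]
  refine Submodule.sum_mem _ fun F hF => Submodule.smul_mem _ _ ?_
  split_ifs with hw
  · exact Submodule.zero_mem _
  · refine Finsupp.single_mem_supported K _ ?_
    convert h F (hz hF) hw

/-- If the largest vertex of every face with at least two vertices is dominated by a smaller
vertex, then the simplicial chain complex is exact in positive degrees. -/
theorem exists_simplexBoundary_eq [WellFoundedLT W] (hκ : Function.Injective κ)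
    (Δ : Set (Finset V)) (hΔ : ∀ F ∈ Δ, ∀ F' ⊆ F, F' ∈ Δ)
    (hdom : ∀ v, (∃ F ∈ Δ, v ∈ F ∧ 2 ≤ F.card ∧ ∀ p ∈ F, κ p ≤ κ v) → ∃ w, κ w < κ v ∧
      ∀ F ∈ Δ, v ∈ F → (∀ p ∈ F, κ p ≤ κ v) → ∀ F', (∀ p, p ∈ F' ↔ p = w ∨ p ∈ F) → F' ∈ Δ)
    (j : ℕ) (hj : 2 ≤ j) (z : Finset V →₀ K)
    (hz : z ∈ Finsupp.supported K K {F | F ∈ Δ ∧ F.card = j}) (hdz : simplexBoundary κ K z = 0) :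
    ∃ y ∈ Finsupp.supported K K {F | F ∈ Δ ∧ F.card = j + 1}, simplexBoundary κ K y = z := by
  classical
  -- The descent is on a strict upper bound for the vertices of the cycle; the added top element
  -- serves as the vacuous initial bound.
  suffices key : ∀ u : WithTop W, ∀ z : Finset V →₀ K,
      z ∈ Finsupp.supported K K {F | F ∈ Δ ∧ F.card = j ∧ ∀ p ∈ F, (κ p : WithTop W) < u} →
      simplexBoundary κ K z = 0 →
      ∃ y ∈ Finsupp.supported K K {F | F ∈ Δ ∧ F.card = j + 1}, simplexBoundary κ K y = z from
    key ⊤ z (mem_supported_mono hz fun F hF => ⟨hF.1, hF.2, fun p _ => WithTop.coe_lt_top _⟩) hdz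
  intro u
  induction u using WellFoundedLT.induction with
  | _ u ih =>
  intro z hz hdz
  by_cases hz0 : z = 0
  · exact ⟨0, Submodule.zero_mem _, by simp [hz0]⟩
  obtain ⟨F₀, hF₀⟩ := Finsupp.support_nonempty_iff.2 hz0
  have hne : (z.support.biUnion id).Nonempty := by
    obtain ⟨p, hp⟩ := Finset.card_pos.1 (show 0 < F₀.card by rw [(hz hF₀).2.1]; omega)
    exact ⟨p, Finset.mem_biUnion.2 ⟨F₀, hF₀, hp⟩⟩
  obtain ⟨v, hv, hmax⟩ := Finset.exists_max_image _ κ hne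
  obtain ⟨F₁, hF₁, hvF₁⟩ := Finset.mem_biUnion.1 hv
  have hle : ∀ F ∈ z.support, ∀ p ∈ F, κ p ≤ κ v := fun F hF p hp =>
    hmax p (Finset.mem_biUnion.2 ⟨F, hF, hp⟩)
  obtain ⟨w, hwv, hw⟩ := hdom v ⟨F₁, (hz hF₁).1, hvF₁, by rw [(hz hF₁).2.1]; exact hj, hle F₁ hF₁⟩
  have hne' : w ≠ v := fun h => hwv.ne (h ▸ rfl)
  -- `y` is the part of the cycle through its largest vertex `v`. Domination keeps the cone over `y`
  -- with apex `w` inside the complex.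
  set y := z.filter (fun F => v ∈ F) with hy
  set r := z.filter (fun F => ¬ v ∈ F) with hr
  have hyr : y + r = z := Finsupp.filter_add_filter_not z _
  have hys : y ∈ Finsupp.supported K K
      {F | F ∈ Δ ∧ F.card = j ∧ v ∈ F ∧ ∀ p ∈ F, κ p ≤ κ v} := by
    intro F hF
    rw [hy, Finsupp.support_filter, Finset.coe_filter] at hF
    exact ⟨(hz hF.1).1, (hz hF.1).2.1, hF.2, hle F hF.1⟩
  have hrs : r ∈ Finsupp.supported K K
      {F | F ∈ Δ ∧ F.card = j ∧ v ∉ F ∧ ∀ p ∈ F, κ p ≤ κ v} := by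
    intro F hF
    rw [hr, Finsupp.support_filter, Finset.coe_filter] at hF
    exact ⟨(hz hF.1).1, (hz hF.1).2.1, hF.2, hle F hF.1⟩
  set x := simplexCone κ K w y with hx
  have hxs : x ∈ Finsupp.supported K K
      {F | F ∈ Δ ∧ F.card = j + 1 ∧ v ∈ F ∧ ∀ p ∈ F, κ p ≤ κ v} := by
    refine simplexCone_mem_supported κ hys fun F hF hwF => ?_
    refine ⟨hw F hF.1 hF.2.2.1 hF.2.2.2 _ fun p => Finset.mem_insert, ?_,
      Finset.mem_insert_of_mem hF.2.2.1, fun p hp => ?_⟩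
    · rw [Finset.card_insert_of_notMem hwF, hF.2.1]
    · rcases Finset.mem_insert.1 hp with rfl | hp
      · exact hwv.le
      · exact hF.2.2.2 p hp
  have hdx : simplexBoundary κ K x ∈ Finsupp.supported K K
      {F | F ∈ Δ ∧ F.card = j ∧ ∀ p ∈ F, κ p ≤ κ v} := by
    refine simplexBoundary_mem_supported κ hxs fun F hF m hm =>
      ⟨hΔ F hF.1 _ (Finset.erase_subset _ _), ?_,
        fun p hp => hF.2.2.2 p (Finset.mem_of_mem_erase hp)⟩
    rw [Finset.card_erase_of_mem hm, hF.2.1]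
    rfl
  -- As `z` is a cycle, the boundary of `y` is minus that of the part avoiding `v`, so it avoids `v`
  -- as well.
  have hdy : simplexBoundary κ K y ∈ Finsupp.supported K K {F | v ∉ F} := by
    have h1 : simplexBoundary κ K y = -simplexBoundary κ K r := by
      rw [eq_neg_iff_add_eq_zero, ← map_add, hyr, hdz]
    rw [h1]
    exact Submodule.neg_mem _ (simplexBoundary_mem_supported κ hrs
      fun F hF m _ h => hF.2.2.1 (Finset.mem_of_mem_erase h))
  -- By the homotopy identity, subtracting the boundary of the cone trades `y` for a chain free of
  -- `v`.
  have hz1 : z - simplexBoundary κ K x = r + simplexCone κ K w (simplexBoundary κ K y) := by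
    rw [← hyr]
    conv_lhs => rw [← simplexBoundary_cone κ hκ w y]
    abel
  have hz1v : z - simplexBoundary κ K x ∈ Finsupp.supported K K {F | v ∉ F} := by
    rw [hz1]
    refine Submodule.add_mem _ (mem_supported_mono hrs fun F hF => hF.2.2.1)
      (simplexCone_mem_supported κ hdy fun F hF _ h => ?_)
    exact (Finset.mem_insert.1 h).elim (fun h => hne' h.symm) hF
  have hz1s : z - simplexBoundary κ K x ∈ Finsupp.supported K K
      {F | F ∈ Δ ∧ F.card = j ∧ ∀ p ∈ F, (κ p : WithTop W) < κ v} := by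
    have h1 : z - simplexBoundary κ K x ∈ Finsupp.supported K K
        {F | F ∈ Δ ∧ F.card = j ∧ ∀ p ∈ F, κ p ≤ κ v} :=
      Submodule.sub_mem _ (fun F hF => ⟨(hz hF).1, (hz hF).2.1, hle F hF⟩) hdx
    intro F hF
    refine ⟨(h1 hF).1, (h1 hF).2.1, fun p hp => WithTop.coe_lt_coe.2 ?_⟩
    exact lt_of_le_of_ne ((h1 hF).2.2 p hp) fun h => hz1v hF (hκ h ▸ hp)
  obtain ⟨y', hy', hdy'⟩ := ih (κ v) ((hz hF₁).2.2 v hvF₁) _ hz1s (by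
    rw [map_sub, hdz, simplexBoundary_simplexBoundary κ hκ, sub_zero])
  refine ⟨y' + x, Submodule.add_mem _ hy'
    (mem_supported_mono hxs fun F hF => ⟨hF.1, hF.2.1⟩), ?_⟩
  rw [map_add, hdy', sub_add_cancel]

end Simplicial

/-! ### Exactness of the Scarf complex -/

section Dominated

variable {n : ℕ} (G : Multigraph n)

theorem reaches_refl (a : Fin (n + 1) →₀ ℕ) : G.Reaches a a :=
  ⟨∅, Finset.notMem_empty _, fun i => by simp [ind, fire_const]⟩

theorem Multigraph.Reaches.add_right {a b : Fin (n + 1) →₀ ℕ} (h : G.Reaches a b)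
    (c : Fin (n + 1) →₀ ℕ) : G.Reaches (a + c) (b + c) := by
  obtain ⟨U, hU, h⟩ := h
  refine ⟨U, hU, fun i => ?_⟩
  rw [Finsupp.add_apply, Finsupp.add_apply, Nat.cast_add, Nat.cast_add, h]
  ring

theorem reaches_lt (hG : G.IsSaturated) {a b : Fin (n + 1) →₀ ℕ} (h : G.Reaches a b)
    (hne : a ≠ b) : (revLex 1).toSyn b < (revLex 1).toSyn a := by
  rw [revLex_lt_iff]
  refine Or.inr ⟨(degree_eq_of_latticeCongr G (h.latticeCongr G)).symm, Fin.last n,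
    fun i hi => absurd hi (not_lt.2 (Fin.le_last i)), ?_⟩
  exact (reaches_last G hG h).resolve_left hne

theorem reaches_of_le (hG : G.IsSaturated) {F : Finset (Fin (n + 1) →₀ ℕ)} (hF : G.IsFace F)
    {v b} (hv : v ∈ F) (hb : b ∈ F) (h : (revLex 1).toSyn b ≤ (revLex 1).toSyn v) :
    G.Reaches v b := by
  rcases hF v hv b hb with h1 | h1
  · exact h1
  · by_cases hne : b = v
    · exact hne ▸ reaches_refl G v
    · exact absurd (reaches_lt G hG h1 hne) (not_lt.2 h)

/-- Legal firing sets avoiding the last node are closed under union: enlarging a set reduces the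
loss of its members and never harms the others. `w` results from firing their union `W`, and
whatever is reached by `U` reaches `w` by firing `W \ U`. -/
theorem exists_largest_reaches (hG : G.IsSaturated) (v : Fin (n + 1) →₀ ℕ) :
    ∃ w, G.Reaches v w ∧ ∀ b, G.Reaches v b → G.Reaches b w ∧ (v = w → b = v) := by
  classical
  let P : Finset (Fin (n + 1)) → Prop := fun U =>
    Fin.last n ∉ U ∧ ∀ i, 0 ≤ (v i : ℤ) - G.fire (fun j => ind (j ∈ U)) i
  let W : Finset (Fin (n + 1)) := Finset.univ.filter fun i => ∃ U, P U ∧ i ∈ U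
  have hsub : ∀ U, P U → U ⊆ W := fun U hU i hi => by
    simp only [W, Finset.mem_filter, Finset.mem_univ, true_and]
    exact ⟨U, hU, hi⟩
  have hWlast : Fin.last n ∉ W := by
    simp only [W, Finset.mem_filter, Finset.mem_univ, true_and]
    rintro ⟨U, hU, h⟩
    exact hU.1 h
  have hmono : ∀ U, U ⊆ W → ∀ j, ind (j ∈ U) ≤ ind (j ∈ W) := fun U hU j => by
    unfold ind
    have := @hU j
    split_ifs <;> simp_all
  have hW : ∀ i, 0 ≤ (v i : ℤ) - G.fire (fun j => ind (j ∈ W)) i := by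
    intro i
    by_cases hi : i ∈ W
    · obtain ⟨U, hU, hiU⟩ : ∃ U, P U ∧ i ∈ U := by simpa [W] using hi
      have h1 : G.fire (fun j => ind (j ∈ W)) i ≤ G.fire (fun j => ind (j ∈ U)) i :=
        fire_le_of_le G fun j => by
          have := hmono U (hsub U hU) j
          simp only [ind_pos hi, ind_pos hiU]
          omega
      have := hU.2 i
      omega
    · have h1 : G.fire (fun j => ind (j ∈ W)) i ≤ G.fire (fun _ => 0) i :=
        fire_le_of_le G fun j => by
          have := ind_nonneg (j ∈ W)
          simp only [ind_neg hi]
          omega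
      rw [fire_const] at h1
      omega
  let w : Fin (n + 1) →₀ ℕ := Finsupp.equivFunOnFinite.symm fun i =>
    ((v i : ℤ) - G.fire (fun j => ind (j ∈ W)) i).toNat
  have hw : ∀ i, (w i : ℤ) = v i - G.fire (fun j => ind (j ∈ W)) i := fun i =>
    Int.toNat_of_nonneg (hW i)
  refine ⟨w, ⟨W, hWlast, hw⟩, fun b hb => ?_⟩
  obtain ⟨U, hU, hb⟩ := hb
  have hUW := hsub U ⟨hU, fun i => by rw [← hb]; positivity⟩
  refine ⟨⟨W \ U, fun h => hWlast (Finset.mem_sdiff.1 h).1, fun i => ?_⟩, fun hvw => ?_⟩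
  · have h1 : G.fire (fun j => ind (j ∈ W \ U)) i =
        G.fire (fun j => ind (j ∈ W)) i - G.fire (fun j => ind (j ∈ U)) i := by
      rw [← fire_sub]
      congr 1
      funext j
      have := @hUW j
      simp only [ind, Finset.mem_sdiff]
      split_ifs <;> simp_all
    rw [h1, hw, hb]
    ring
  · have h1 := eq_of_fire_eq_zero G hG (g := fun j => ind (j ∈ W)) fun i => by
      have := hw i
      rw [← hvw] at this
      omega
    have hU0 : U = ∅ := by
      by_contra hne
      obtain ⟨i, hi⟩ := Finset.nonempty_iff_ne_empty.2 hne
      have := h1 i (Fin.last n)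
      rw [ind_pos (hUW hi), ind_neg hWlast] at this
      omega
    ext i
    have := hb i
    simp only [hU0, ind, Finset.notMem_empty, if_false, fire_const, sub_zero] at this
    exact_mod_cast this

theorem exists_simplexBoundary_eq_of_isFace (K : Type*) [Field K] (hG : G.IsSaturated) (j : ℕ)
    (hj : 2 ≤ j) (z : Finset (Fin (n + 1) →₀ ℕ) →₀ K)
    (hz : z ∈ Finsupp.supported K K {F | G.IsFace F ∧ F.card = j})
    (hdz : simplexBoundary (revLex (1 : Equiv.Perm (Fin (n + 1)))).toSyn K z = 0) :
    ∃ y ∈ Finsupp.supported K K {F | G.IsFace F ∧ F.card = j + 1},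
      simplexBoundary (revLex (1 : Equiv.Perm (Fin (n + 1)))).toSyn K y = z := by
  refine exists_simplexBoundary_eq (revLex (1 : Equiv.Perm (Fin (n + 1)))).toSyn
    (revLex 1).toSyn.injective
    {F | G.IsFace F} (fun F hF F' h a ha b hb => hF a (h ha) b (h hb)) ?_ j hj z hz hdz
  rintro v ⟨F, hF, hvF, hcard, hle⟩
  obtain ⟨w, hvw, hw⟩ := exists_largest_reaches G hG v
  refine ⟨w, reaches_lt G hG hvw fun h => ?_, ?_⟩
  · obtain ⟨b, hb, hbv⟩ := Finset.exists_mem_ne (by omega : 1 < F.card) v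
    exact hbv ((hw b (reaches_of_le G hG hF hvF hb (hle b hb))).2 h)
  · intro F hF hvF hle F' hF'
    have hbw : ∀ b ∈ F, G.Reaches b w := fun b hb =>
      (hw b (reaches_of_le G hG hF hvF hb (hle b hb))).1
    intro a ha b hb
    rcases (hF' a).1 ha with rfl | ha <;> rcases (hF' b).1 hb with rfl | hb
    · exact Or.inl (reaches_refl G _)
    · exact Or.inr (hbw b hb)
    · exact Or.inl (hbw a ha)
    · exact hF a ha b hb

end Dominated

/-! ### Scarf modules as spaces of simplicial chains. -/

section FaceChains

variable {σ : Type*} (K : Type*) [Field K] (L : Submodule ℤ (σ → ℤ)) (k : ℕ)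

/-- A basic fiber multiplied by a monomial. -/
noncomputable def translate (p : BasicFiber L k × (σ →₀ ℕ)) : Finset (σ →₀ ℕ) :=
  p.1.1.map (addRightEmbedding p.2)

theorem mem_translate {p : BasicFiber L k × (σ →₀ ℕ)} {b} :
    b ∈ translate L k p ↔ ∃ c ∈ p.1.1, b = c + p.2 := by
  simp [translate, eq_comm]

/-- A basic fiber has gcd `1`, so the monomial factor is recovered as the gcd of the translate. The
index `k + 1` ensures that the set is non-empty. -/
theorem translate_injective [Fintype σ] : Function.Injective (translate L (k + 1)) := by
  have hgcd : ∀ p : BasicFiber L (k + 1) × (σ →₀ ℕ), gcdExponent (translate L (k + 1) p) = p.2 :=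
    fun p => gcdExponent_eq (fun b => mem_translate L (k + 1)) p.1.2.1.2.1
      ((Finset.card_pos.1 (by rw [p.1.2.2]; omega)).map)
  rintro ⟨C, a⟩ ⟨C', a'⟩ h
  have ha : a = a' := (hgcd (C, a)).symm.trans (h ▸ hgcd (C', a'))
  subst ha
  rw [Subtype.ext (Finset.map_injective _ h) (a1 := C)]

/-- The identification of the Scarf complex with a complex of simplicial chains. -/
noncomputable def faceChain : (BasicFiber L k →₀ MvPolynomial σ K) →ₗ[K] (Finset (σ →₀ ℕ) →₀ K) :=
  Finsupp.lmapDomain K K (translate L k) ∘ₗ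
    ((Finsupp.curryLinearEquiv K).symm.toLinearMap ∘ₗ
      (Finsupp.mapRange.linearEquiv (basisMonomials σ K).repr).toLinearMap)

theorem faceChain_single (C : BasicFiber L k) (a : σ →₀ ℕ) (r : K) :
    faceChain K L k (Finsupp.single C (monomial a r)) = Finsupp.single (translate L k (C, a)) r := by
  have h : (basisMonomials σ K).repr (monomial a r) = Finsupp.single a r := rfl
  simp [faceChain, h, Finsupp.curryLinearEquiv]

theorem faceChain_injective [Fintype σ] : Function.Injective (faceChain K L (k + 1)) := by
  rw [faceChain, LinearMap.coe_comp]
  exact (Finsupp.mapDomain_injective (translate_injective L k)).comp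
    ((Finsupp.curryLinearEquiv K).symm.injective.comp (LinearEquiv.injective _))

theorem range_faceChain : LinearMap.range (faceChain K L k) =
    Finsupp.supported K K (Set.range (translate L k)) := by
  rw [faceChain, LinearMap.range_comp_of_range_eq_top, ← Set.image_univ,
    ← Finsupp.lmapDomain_supported, Finsupp.supported_univ, Submodule.map_top]
  rw [LinearMap.range_eq_top]
  exact ((Finsupp.curryLinearEquiv K).symm.surjective.comp (LinearEquiv.surjective _))

/-- Division by the gcd in the Scarf differential is compensated by its coefficient, so on
translates it is plain removal of a vertex. -/
theorem translate_remove [Fintype σ] [DecidableEq (σ →₀ ℕ)] {k : ℕ} (C : BasicFiber L (k + 2)) (m : {m // m ∈ C.1})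
    (a : σ →₀ ℕ) : translate L (k + 1) (C.remove m, a + gcdExponent (C.1.erase m.1)) =
      (translate L (k + 2) (C, a)).erase (m.1 + a) := by
  ext b
  rw [Finset.mem_erase, mem_translate, mem_translate]
  simp only [BasicFiber.remove, removeMonomial, Finset.mem_image]
  constructor
  · rintro ⟨c, ⟨d, hd, rfl⟩, rfl⟩
    have hd' : d ∈ C.1.erase m.1 := by simpa [Finset.mem_erase] using hd
    have h1 := gcdExponent_le hd'
    have h2 : d - gcdExponent (C.1.erase m.1) + (a + gcdExponent (C.1.erase m.1)) = d + a := by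
      rw [add_comm a, ← add_assoc, tsub_add_cancel_of_le h1]
    rw [Finset.mem_erase] at hd'
    have h3 : ∀ x : σ →₀ ℕ, x = d + a → x ≠ m.1 + a ∧ ∃ c ∈ C.1, x = c + a := by
      rintro _ rfl
      exact ⟨fun h => hd'.1 (add_right_cancel h), d, hd'.2, rfl⟩
    apply h3
    convert h2
  · rintro ⟨hne, d, hd, rfl⟩
    have hd' : d ∈ C.1.erase m.1 := Finset.mem_erase.2 ⟨fun h => hne (h ▸ rfl), hd⟩
    have h1 := gcdExponent_le hd'
    refine ⟨d - gcdExponent (C.1.erase m.1), ⟨d, by simpa [Finset.mem_erase] using hd', ?_⟩, ?_⟩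
    · congr!
    · rw [add_comm a, ← add_assoc, tsub_add_cancel_of_le h1]

theorem faceChain_scarfBoundary [Fintype σ] (ord : MonomialOrder σ) (z) :
    faceChain K L (k + 1) (scarfBoundary K L ord k z) =
      simplexBoundary ord.toSyn K (faceChain K L (k + 2) z) := by
  classical
  suffices h : faceChain K L (k + 1) ∘ₗ (scarfBoundary K L ord k).restrictScalars K =
      simplexBoundary ord.toSyn K ∘ₗ faceChain K L (k + 2) from LinearMap.congr_fun h z
  refine Finsupp.lhom_ext' fun C => MvPolynomial.linearMap_ext fun a => LinearMap.ext_ring ?_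
  simp only [LinearMap.comp_apply, Finsupp.lsingle_apply, LinearMap.restrictScalars_apply,
    faceChain_single]
  rw [scarfBoundary, Finsupp.linearCombination_single, simplexBoundary_single, one_smul,
    Finset.smul_sum, map_sum, translate, Finset.sum_map]
  refine Eq.trans (Finset.sum_congr rfl fun m _ => ?_) (Finset.sum_attach C.1 _)
  have h1 : position ord.toSyn (translate L (k + 2) (C, a)) (m.1 + a) =
      (C.1.filter fun p => ord.toSyn p < ord.toSyn m.1).card := by
    rw [position, translate, Finset.filter_map, Finset.card_map]
    congr 1
    ext p
    simp
  have h2 : ((-1) ^ (C.1.filter fun p => ord.toSyn p < ord.toSyn m.1).card : MvPolynomial σ K) =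
      monomial 0 ((-1) ^ (C.1.filter fun p => ord.toSyn p < ord.toSyn m.1).card) := by
    rw [← C_apply, map_pow, map_neg, C_1]
  have h3 := translate_remove L C m a
  rw [Finsupp.smul_single, smul_eq_mul]
  simp only [addRightEmbedding_apply]
  change _ = Finsupp.single ((translate L (k + 2) (C, a)).erase (m.1 + a))
    ((-1) ^ position ord.toSyn (translate L (k + 2) (C, a)) (m.1 + a))
  rw [h1, ← h3, ← faceChain_single]
  congr 2
  have h4 : monomial a (1 : K) * ((-1) ^ (C.1.filter fun p => ord.toSyn p < ord.toSyn m.1).card *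
      monomial (gcdExponent (C.1.erase m.1)) 1) = monomial (a + gcdExponent (C.1.erase m.1))
        ((-1) ^ (C.1.filter fun p => ord.toSyn p < ord.toSyn m.1).card) := by
    rw [h2, monomial_mul, monomial_mul, zero_add, one_mul, mul_one]
  convert h4 using 3

end FaceChains

/-! ### Exactness in positive homological degrees and its transfer to the cyclic complex. -/

section Exactness

variable {n : ℕ} (G : Multigraph n)

theorem range_translate (hG : G.IsSaturated) (k : ℕ) :
    Set.range (translate G.lattice (k + 1)) = {F | G.IsFace F ∧ F.card = k + 1} := by
  ext F
  constructor
  · rintro ⟨⟨C, a⟩, rfl⟩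
    refine ⟨fun x hx y hy => ?_, by rw [translate, Finset.card_map, C.2.2]⟩
    obtain ⟨c, hc, rfl⟩ := (mem_translate _ _).1 hx
    obtain ⟨d, hd, rfl⟩ := (mem_translate _ _).1 hy
    exact (C.2.1.isFace G hG c hc d hd).imp (fun h => h.add_right G a) (fun h => h.add_right G a)
  · rintro ⟨hF, hcard⟩
    obtain ⟨t, -, a, ha⟩ := hF.exists_orderedPartition G hG hcard
    refine ⟨⟨⟨G.cycFiber t.1, cycFiber_isBasicFiber G hG t, card_cycFiber G hG t⟩, a⟩, ?_⟩
    ext b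
    rw [mem_translate, ha]
    simp only [mem_cycFiber, exists_exists_eq_and]

theorem scarf_exact (K : Type*) [Field K] (hG : G.IsSaturated) (k : ℕ) :
    Function.Exact (scarfBoundary K G.lattice (revLex (1 : Equiv.Perm (Fin (n + 1)))) (k + 1))
      (scarfBoundary K G.lattice (revLex (1 : Equiv.Perm (Fin (n + 1)))) k) := by
  intro z
  constructor
  · intro hz
    have hsupp : faceChain K G.lattice (k + 2) z ∈
        Finsupp.supported K K {F | G.IsFace F ∧ F.card = k + 2} := by
      rw [← range_translate G hG (k + 1), ← range_faceChain]
      exact ⟨z, rfl⟩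
    obtain ⟨y, hy, hyz⟩ := exists_simplexBoundary_eq_of_isFace G K hG (k + 2) (by omega) _ hsupp
      (by rw [← faceChain_scarfBoundary, hz, map_zero])
    rw [← range_translate G hG (k + 2), ← range_faceChain] at hy
    obtain ⟨y, rfl⟩ := hy
    refine ⟨y, faceChain_injective K G.lattice (k + 1) ?_⟩
    rw [faceChain_scarfBoundary, hyz]
  · rintro ⟨y, rfl⟩
    refine faceChain_injective K G.lattice k ?_
    rw [faceChain_scarfBoundary, faceChain_scarfBoundary, map_zero,
      simplexBoundary_simplexBoundary _ (revLex 1).toSyn.injective]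

theorem CoincidesVia.exact {R : Type*} [CommRing R] {B B' : ℕ → Type*} {e : ∀ k, B k ≃ B' k}
    {d : ∀ k, (B (k + 1) →₀ R) →ₗ[R] (B k →₀ R)}
    {d' : ∀ k, (B' (k + 1) →₀ R) →ₗ[R] (B' k →₀ R)} (h : CoincidesVia e d d') (k : ℕ)
    (hk : Function.Exact (d' (k + 1)) (d' k)) : Function.Exact (d (k + 1)) (d k) := by
  obtain ⟨ε, -, h⟩ := h
  have hε : ∀ k b, (((ε k b : ℤˣ) : ℤ) : R) * (((ε k b : ℤˣ) : ℤ) : R) = 1 := fun k b => by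
    rw [← Int.cast_mul, ← Units.val_mul, Int.units_mul_self, Units.val_one, Int.cast_one]
  let E : ∀ k, (B k →₀ R) →ₗ[R] (B' k →₀ R) := fun k =>
    Finsupp.linearCombination R fun c => Finsupp.single (e k c) (((ε k c : ℤˣ) : ℤ) : R)
  let E' : ∀ k, (B' k →₀ R) →ₗ[R] (B k →₀ R) := fun k =>
    Finsupp.linearCombination R fun c =>
      Finsupp.single ((e k).symm c) (((ε k ((e k).symm c) : ℤˣ) : ℤ) : R)
  have hEd : ∀ k z, d' k (E (k + 1) z) = E k (d k z) := fun k z => by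
    suffices h' : d' k ∘ₗ E (k + 1) = E k ∘ₗ d k from LinearMap.congr_fun h' z
    refine Finsupp.lhom_ext' fun b => LinearMap.ext_ring ?_
    simp only [LinearMap.comp_apply, Finsupp.lsingle_apply]
    rw [← h k b]
    simp [E]
  have hE'E : ∀ k z, E' k (E k z) = z := fun k z => by
    suffices h' : E' k ∘ₗ E k = LinearMap.id from LinearMap.congr_fun h' z
    refine Finsupp.lhom_ext' fun b => LinearMap.ext_ring ?_
    simp [E, E', hε]
  have hEE' : ∀ k z, E k (E' k z) = z := fun k z => by
    suffices h' : E k ∘ₗ E' k = LinearMap.id from LinearMap.congr_fun h' z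
    refine Finsupp.lhom_ext' fun b => LinearMap.ext_ring ?_
    simp [E, E', hε]
  intro z
  constructor
  · intro hz
    obtain ⟨y, hy⟩ := (hk (E (k + 1) z)).1 (by rw [hEd, hz, map_zero])
    refine ⟨E' (k + 2) y, ?_⟩
    rw [← hE'E (k + 1) (d (k + 1) _), ← hEd, hEE', hy, hE'E]
  · rintro ⟨y, rfl⟩
    rw [← hE'E k (d k _), ← hEd, ← hEd, (hk _).2 ⟨_, rfl⟩, map_zero]

end Exactness

/-! ### Splits and Gröbner bases -/

section Splits

variable {n : ℕ} (G : Multigraph n) {I J I' J' : Finset (Fin (n + 1))}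

theorem IsSplit.symm (h : IsSplit I J) : IsSplit J I :=
  ⟨h.2.1, h.1, h.2.2.1.symm, by rw [Finset.union_comm, h.2.2.2]⟩

theorem IsSplit.mem_iff (h : IsSplit I J) (i) : i ∈ J ↔ i ∉ I := by
  have h1 : i ∈ I ∪ J := h.2.2.2 ▸ Finset.mem_univ i
  rw [Finset.mem_union] at h1
  exact ⟨fun hJ hI => Finset.disjoint_left.1 h.2.2.1 hI hJ, fun hI => h1.resolve_left hI⟩

theorem isSplit_compl {U : Finset (Fin (n + 1))} (h : U.Nonempty) (h' : ∃ i, i ∉ U) :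
    IsSplit U Uᶜ :=
  ⟨h, h'.imp fun _ hi => Finset.mem_compl.2 hi, disjoint_compl_right, Finset.union_compl U⟩

theorem IsSplit.eq_compl (h : IsSplit I J) : J = Iᶜ := by
  ext i
  rw [h.mem_iff, Finset.mem_compl]

theorem arrowExp_split (h : IsSplit I J) (i) :
    (G.arrowExp J I i : ℤ) = G.arrowExp I J i - G.fire (fun j => ind (j ∈ I)) i := by
  have h1 : ∀ U : Finset (Fin (n + 1)), ((∑ k ∈ U, G.mult i k : ℕ) : ℤ) =
      ∑ k, (G.mult i k : ℤ) * ind (k ∈ U) := fun U => by simp [ind]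
  rw [arrowExp_apply, arrowExp_apply, Multigraph.fire]
  by_cases hi : i ∈ I
  · rw [if_neg (fun hJ => (h.mem_iff i).1 hJ hi), if_pos hi, h1, ← Finset.sum_sub_distrib,
      Nat.cast_zero]
    refine (Finset.sum_eq_zero fun j _ => ?_).symm
    simp only [ind, h.mem_iff, hi]
    split_ifs <;> simp_all
  · rw [if_pos ((h.mem_iff i).2 hi), if_neg hi, h1, Nat.cast_zero, zero_sub,
      ← Finset.sum_neg_distrib]
    refine Finset.sum_congr rfl fun j _ => ?_
    rw [ind_neg hi]
    ring

theorem arrowExp_latticeCongr (h : IsSplit I J) :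
    LatticeCongr G.lattice (G.arrowExp I J) (G.arrowExp J I) :=
  (latticeCongr_iff G).2 ⟨_, arrowExp_split G h⟩

theorem arrowExp_pos (hG : G.IsSaturated) {i j} (hi : i ∈ I) (hj : j ∈ J) (hij : i ≠ j) :
    0 < G.arrowExp I J i := by
  rw [arrowExp_apply, if_pos hi]
  exact (hG i j hij).trans_le (Finset.single_le_sum (fun _ _ => Nat.zero_le _) hj)

theorem arrowExp_of_notMem {i} (hi : i ∉ I) : G.arrowExp I J i = 0 := by
  rw [arrowExp_apply, if_neg hi]

theorem IsSplit.arrowExp_ne (hG : G.IsSaturated) (h : IsSplit I J) (i) :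
    G.arrowExp I J i ≠ G.arrowExp J I i := by
  have key : ∀ {I J : Finset (Fin (n + 1))}, IsSplit I J → i ∈ I →
      G.arrowExp I J i ≠ G.arrowExp J I i := by
    intro I J h hi
    obtain ⟨j, hj⟩ := h.2.1
    rw [arrowExp_of_notMem G (fun hJ => (h.mem_iff i).1 hJ hi)]
    exact (arrowExp_pos G hG hi hj fun hij => (h.mem_iff j).1 hj (hij ▸ hi)).ne'
  by_cases hi : i ∈ I
  · exact key h hi
  · exact (key h.symm ((h.mem_iff i).2 hi)).symm

/-- The support of `x^{I → J}` is exactly `I`, so divisibility gives `I' ⊆ I`. Were the inclusion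
strict, `J'` would be larger than `J`, and by saturation so would the exponents on `I'`. -/
theorem eq_of_arrowExp_le (hG : G.IsSaturated) (h : IsSplit I J) (h' : IsSplit I' J')
    (hle : G.arrowExp I' J' ≤ G.arrowExp I J) : I' = I ∧ J' = J := by
  have hsub : I' ⊆ I := by
    intro i hi
    by_contra hiI
    obtain ⟨j, hj⟩ := h'.2.1
    have h1 := arrowExp_pos G hG hi hj fun hij => (h'.mem_iff j).1 hj (hij ▸ hi)
    have h2 := hle i
    rw [arrowExp_of_notMem G hiI] at h2
    omega
  have hII : I' = I := by
    refine hsub.antisymm fun j hj => ?_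
    by_contra hjI'
    obtain ⟨i, hi⟩ := h'.1
    have h1 := hle i
    rw [arrowExp_apply, arrowExp_apply, if_pos hi, if_pos (hsub hi)] at h1
    have h2 : ∑ k ∈ J, G.mult i k < ∑ k ∈ J', G.mult i k := by
      refine Finset.sum_lt_sum_of_subset (fun k hk => (h'.mem_iff k).2 fun hkI' =>
        (h.mem_iff k).1 hk (hsub hkI')) ((h'.mem_iff j).2 hjI') (fun hJ => (h.mem_iff j).1 hJ hj)
        (hG i j fun hij => hjI' (hij ▸ hi)) fun _ _ _ => Nat.zero_le _
    omega
  exact ⟨hII, by rw [h'.eq_compl, h.eq_compl, hII]⟩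

variable (π : Equiv.Perm (Fin (n + 1)))

theorem arrowExp_lt (hG : G.IsSaturated) (h : IsSplit I J) (hq : π (Fin.last n) ∉ I) :
    (revLex π).toSyn (G.arrowExp J I) < (revLex π).toSyn (G.arrowExp I J) := by
  rw [revLex_lt_iff]
  refine Or.inr ⟨(degree_eq_of_latticeCongr G (arrowExp_latticeCongr G h)).symm, Fin.last n,
    fun i hi => absurd hi (not_lt.2 (Fin.le_last i)), ?_⟩
  obtain ⟨i, hi⟩ := h.1
  rw [arrowExp_of_notMem G hq]
  exact arrowExp_pos G hG ((h.mem_iff _).2 hq) hi fun h => hq (h ▸ hi)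

/-- A monomial that is not the smallest one of its fiber is divisible by the leading monomial
of the binomial of a split. -/
theorem exists_split_le (hG : G.IsSaturated) {a b : Fin (n + 1) →₀ ℕ}
    (h : LatticeCongr G.lattice a b) (hlt : (revLex π).toSyn b < (revLex π).toSyn a) :
    ∃ I J, IsSplit I J ∧ π (Fin.last n) ∉ I ∧ G.arrowExp I J ≤ a := by
  obtain ⟨g, hg⟩ := (latticeCongr_iff G).1 h
  obtain ⟨m, -, hm⟩ := Finset.exists_max_image Finset.univ g ⟨0, Finset.mem_univ _⟩
  have hmax : ∀ i, g i ≤ g m := fun i => hm i (Finset.mem_univ _)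
  -- If the node of the smallest variable attained the maximum of a non-constant `g`, its exponent
  -- would drop, but a smaller monomial of the same degree cannot have a smaller exponent there.
  have hq : g (π (Fin.last n)) ≠ g m := by
    intro hq
    by_cases hconst : ∀ j, g j = g m
    · refine hlt.ne (congrArg _ ?_)
      ext i
      have h1 := hg i
      rw [fire_congr_of_sub_const G (h := fun _ => 0) (g m) (fun j => by rw [hconst]; ring),
        fire_const, sub_zero] at h1
      exact_mod_cast h1
    · push Not at hconst
      obtain ⟨j, hj⟩ := hconst
      have h1 : G.fire (fun _ => 0) (π (Fin.last n)) < G.fire g (π (Fin.last n)) := by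
        refine fire_lt_of_lt G hG (j := j) (fun k => ?_) ?_
        · have := hmax k
          omega
        · have := hmax j
          omega
      rw [fire_const] at h1
      have h2 := hg (π (Fin.last n))
      rcases (revLex_lt_iff π b a).1 hlt with h3 | ⟨-, j, h3, h4⟩
      · rw [degree_eq_of_latticeCongr G h] at h3
        exact lt_irrefl _ h3
      · rcases (Fin.le_last j).lt_or_eq with h5 | rfl
        · have := h3 _ h5
          omega
        · omega
  -- Fire only the level set of the maximum: each of its nodes loses at most what it loses under
  -- `g`, which is affordable because `b` is non-negative.
  refine ⟨Finset.univ.filter fun i => g i = g m, _, isSplit_compl ⟨m, by simp⟩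
    ⟨π (Fin.last n), by simpa using hq⟩, by simpa using hq, fun i => ?_⟩
  by_cases hi : g i = g m
  · have hs := isSplit_compl (U := Finset.univ.filter fun i => g i = g m) ⟨m, by simp⟩
      ⟨π (Fin.last n), by simpa using hq⟩
    have h1 := arrowExp_split G hs i
    rw [arrowExp_of_notMem G (by simpa using hi)] at h1
    have h2 : G.fire (fun j => ind (j ∈ Finset.univ.filter fun i => g i = g m)) i ≤ G.fire g i :=
      fire_le_of_le G fun j => by
        have := hmax j
        simp only [ind, Finset.mem_filter, Finset.mem_univ, true_and, hi]
        split_ifs <;> omega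
    have h3 := hg i
    omega
  · rw [arrowExp_of_notMem G (by simpa using hi)]
    exact Nat.zero_le _

end Splits

/-! ### Lattice ideals and generation by split binomials. -/

section Ideals

theorem linearMap_eq_zero_of_mem_span {σ K M : Type*} [Field K] [AddCommGroup M] [Module K M]
    (φ : MvPolynomial σ K →ₗ[K] M) {S : Set (MvPolynomial σ K)}
    (h : ∀ s ∈ S, ∀ m, φ (monomial m 1 * s) = 0) {f} (hf : f ∈ Ideal.span S) : φ f = 0 := by
  suffices h' : ∀ m, φ (monomial m 1 * f) = 0 by
    have := h' 0
    rwa [← C_apply, C_1, one_mul] at this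
  induction hf using Submodule.span_induction with
  | mem s hs => exact h s hs
  | zero => simp
  | add x y _ _ hx hy => intro m; rw [mul_add, map_add, hx, hy, add_zero]
  | smul p x _ hx =>
    intro m
    rw [smul_eq_mul]
    induction p using MvPolynomial.induction_on' with
    | monomial u c =>
      have h1 : monomial m (1 : K) * (monomial u c * x) = c • (monomial (m + u) 1 * x) := by
        rw [← mul_assoc, monomial_mul, one_mul, ← smul_mul_assoc, smul_monomial, smul_eq_mul,
          mul_one]
      rw [h1, map_smul, hx, smul_zero]
    | add p q hp hq => rw [add_mul, mul_add, map_add, hp, hq, add_zero]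

-- Summing the coefficients over one congruence class gives a functional that kills the lattice
-- ideal, so no class can meet the support in a single monomial.
open Classical in
theorem exists_mem_support_latticeCongr {σ K : Type*} [Field K] {L : Submodule ℤ (σ → ℤ)}
    {f : MvPolynomial σ K} (hf : f ∈ latticeIdeal K L) {a : σ →₀ ℕ} (ha : a ∈ f.support) :
    ∃ b ∈ f.support, b ≠ a ∧ LatticeCongr L a b := by
  by_contra! hno
  let φ : MvPolynomial σ K →ₗ[K] K := (basisMonomials σ K).constr K fun m =>
    if LatticeCongr L a m then (1 : K) else 0
  have hφ : ∀ m c, φ (monomial m c) = if LatticeCongr L a m then c else 0 := fun m c => by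
    have h1 : monomial m c = c • basisMonomials σ K m := by
      rw [coe_basisMonomials, smul_monomial, smul_eq_mul, mul_one]
    rw [h1, map_smul, Module.Basis.constr_basis]
    split_ifs <;> simp
  have h0 : φ f = 0 := by
    refine linearMap_eq_zero_of_mem_span φ ?_ hf
    rintro _ ⟨b, c, hbc, rfl⟩ m
    rw [mul_sub, monomial_mul, monomial_mul, map_sub, hφ, hφ, sub_eq_zero, one_mul]
    have h1 : LatticeCongr L (m + b) (m + c) := by
      rw [add_comm m, add_comm m]
      exact hbc.add_right m
    exact if_congr ⟨fun h => h.trans' h1, fun h => h.trans' h1.symm'⟩ rfl rfl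
  rw [f.as_sum, map_sum, Finset.sum_eq_single a] at h0
  · rw [hφ, if_pos] at h0
    · exact mem_support_iff.1 ha h0
    · unfold LatticeCongr
      simp only [sub_self]
      exact L.zero_mem
  · intro b hb hba
    rw [hφ, if_neg (hno b hb hba)]
  · exact fun h => absurd ha h

variable {n : ℕ} (G : Multigraph n) (K : Type*) [Field K]

/-- The binomials of all splits, with both signs. -/
def Multigraph.splitBinomials : Set (MvPolynomial (Fin (n + 1)) K) :=
  (fun p : (Fin (n + 1) →₀ ℕ) × (Fin (n + 1) →₀ ℕ) => monomial p.1 (1 : K) - monomial p.2 1) ''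
    {p | ∃ I J, IsSplit I J ∧ p = (G.arrowExp I J, G.arrowExp J I)}

variable {K}

theorem mem_splitBinomials {I J : Finset (Fin (n + 1))} (h : IsSplit I J) :
    monomial (G.arrowExp I J) (1 : K) - monomial (G.arrowExp J I) 1 ∈ G.splitBinomials K :=
  ⟨_, ⟨I, J, h, rfl⟩, rfl⟩

variable (K)

/-- The larger of two congruent monomials is not minimal in its fiber, so a split binomial replaces
it by a smaller congruent one; well-founded descent ends when the two coincide. -/
theorem sub_mem_span_splitBinomials (hG : G.IsSaturated) {a b : Fin (n + 1) →₀ ℕ}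
    (h : LatticeCongr G.lattice a b) :
    monomial a (1 : K) - monomial b 1 ∈ Ideal.span (G.splitBinomials K) := by
  have hstep : ∀ a b : Fin (n + 1) →₀ ℕ, LatticeCongr G.lattice a b →
      (revLex 1).toSyn b < (revLex 1).toSyn a → ∃ a', LatticeCongr G.lattice a a' ∧
        (revLex 1).toSyn a' < (revLex 1).toSyn a ∧
        monomial a (1 : K) - monomial a' 1 ∈ Ideal.span (G.splitBinomials K) := by
    intro a b h hlt
    obtain ⟨I, J, hIJ, hq, hle⟩ := exists_split_le G 1 hG h hlt
    obtain ⟨c, rfl⟩ := exists_add_of_le hle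
    refine ⟨G.arrowExp J I + c, (arrowExp_latticeCongr G hIJ).add_right c, ?_, ?_⟩
    · rw [map_add, map_add]
      exact add_lt_add_left (arrowExp_lt G 1 hG hIJ hq) _
    · have := Ideal.mul_mem_left _ (monomial c (1 : K)) (Ideal.subset_span (mem_splitBinomials G hIJ))
      rwa [mul_sub, monomial_mul, monomial_mul, one_mul, add_comm c, add_comm c] at this
  have key : ∀ u : (revLex (1 : Equiv.Perm (Fin (n + 1)))).syn, ∀ a b,
      (revLex 1).toSyn a = u → LatticeCongr G.lattice a b →
      (revLex 1).toSyn b ≤ (revLex 1).toSyn a →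
      monomial a (1 : K) - monomial b 1 ∈ Ideal.span (G.splitBinomials K) := by
    intro u
    induction u using WellFoundedLT.induction with
    | _ u ih =>
    rintro a b rfl h hle
    rcases hle.lt_or_eq with hlt | heq
    · obtain ⟨a', h', hlt', hmem⟩ := hstep a b h hlt
      rw [← sub_add_sub_cancel _ (monomial a' (1 : K))]
      refine Ideal.add_mem _ hmem ?_
      rcases le_total ((revLex 1).toSyn b) ((revLex 1).toSyn a') with h1 | h1
      · exact ih _ hlt' a' b rfl (h'.symm'.trans' h) h1
      · have := ih _ hlt b a' rfl (h.symm'.trans' h') h1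
        rw [← neg_sub]
        exact neg_mem this
    · rw [(revLex 1).toSyn.injective heq, sub_self]
      exact Ideal.zero_mem _
  rcases le_total ((revLex 1).toSyn b) ((revLex 1).toSyn a) with h1 | h1
  · exact key _ a b rfl h h1
  · rw [← neg_sub]
    exact neg_mem (key _ b a rfl h.symm' h1)

theorem topplingIdeal_eq_span (hG : G.IsSaturated) :
    G.topplingIdeal K = Ideal.span (G.splitBinomials K) := by
  refine le_antisymm (Ideal.span_le.2 ?_) (Ideal.span_mono ?_)
  · rintro _ ⟨a, b, h, rfl⟩
    exact sub_mem_span_splitBinomials G K hG h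
  · rintro _ ⟨_, ⟨I, J, h, rfl⟩, rfl⟩
    exact ⟨_, _, arrowExp_latticeCongr G h, rfl⟩

theorem isGenericLatticeIdeal (hG : G.IsSaturated) :
    IsGenericLatticeIdeal (G.topplingIdeal K) := by
  refine ⟨G.lattice, fun v hv hv0 => ?_, rfl,
    {p | ∃ I J, IsSplit I J ∧ p = (G.arrowExp I J, G.arrowExp J I)}, ?_,
    topplingIdeal_eq_span G K hG⟩
  · obtain ⟨g, rfl⟩ := (mem_lattice_iff G).1 hv
    funext i
    exact (Finset.sum_eq_zero_iff_of_nonneg fun i _ => hv0 i).1 (sum_fire G g) i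
      (Finset.mem_univ _)
  · rintro _ ⟨I, J, h, rfl⟩ i
    exact h.arrowExp_ne G hG i

end Ideals

/-! ### Minimality, Gröbner bases and the number of splits. -/

section SplitBinomials

variable {n : ℕ} (G : Multigraph n) {K : Type*} [Field K]
  {B : splits n → MvPolynomial (Fin (n + 1)) K}

theorem Multigraph.IsSplitBinomials.exists_monomial (hB : G.IsSplitBinomials B) (s : splits n) :
    ∃ I J, IsSplit I J ∧ s.1 = s(I, J) ∧
      B s = monomial (G.arrowExp I J) 1 - monomial (G.arrowExp J I) 1 := by
  obtain ⟨I, J, h, hs, hB⟩ := hB s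
  exact ⟨I, J, h, hs, by rw [hB, arrow_eq_monomial, arrow_eq_monomial]⟩

theorem Multigraph.IsSplitBinomials.eq_or_eq_neg (hB : G.IsSplitBinomials B)
    {I J : Finset (Fin (n + 1))} (h : IsSplit I J) :
    ∃ s, B s = monomial (G.arrowExp I J) 1 - monomial (G.arrowExp J I) 1 ∨
      B s = -(monomial (G.arrowExp I J) 1 - monomial (G.arrowExp J I) 1) := by
  obtain ⟨I', J', h', hs, hBs⟩ := hB.exists_monomial G ⟨s(I, J), I, J, h, rfl⟩
  refine ⟨⟨s(I, J), I, J, h, rfl⟩, ?_⟩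
  rcases Sym2.eq_iff.1 hs with ⟨rfl, rfl⟩ | ⟨rfl, rfl⟩
  · exact Or.inl hBs
  · exact Or.inr (hBs.trans (neg_sub _ _).symm)

theorem Multigraph.IsSplitBinomials.span_eq (hG : G.IsSaturated) (hB : G.IsSplitBinomials B) :
    Ideal.span (Set.range B) = G.topplingIdeal K := by
  rw [topplingIdeal_eq_span G K hG]
  refine le_antisymm (Ideal.span_mono ?_) (Ideal.span_le.2 ?_)
  · rintro _ ⟨s, rfl⟩
    obtain ⟨I, J, h, -, hBs⟩ := hB.exists_monomial G s
    rw [hBs]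
    exact mem_splitBinomials G h
  · rintro _ ⟨_, ⟨I, J, h, rfl⟩, rfl⟩
    obtain ⟨s, hs | hs⟩ := hB.eq_or_eq_neg G h
    · exact Ideal.subset_span ⟨s, hs⟩
    · have : B s ∈ Ideal.span (Set.range B) := Ideal.subset_span ⟨s, rfl⟩
      rw [hs] at this
      exact neg_mem_iff.1 this

/-- The coefficient at `x^{I → J}` detects a single split, since no other split has a monomial
dividing it. Distinctness and irredundancy both follow from this functional. -/
theorem Multigraph.IsSplitBinomials.exists_coeff (hG : G.IsSaturated) (hB : G.IsSplitBinomials B)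
    (s : splits n) : ∃ a, coeff a (B s) = 1 ∧
      ∀ s' m, coeff a (monomial m 1 * B s') ≠ 0 → s' = s := by
  classical
  obtain ⟨I, J, h, hs, hBs⟩ := hB.exists_monomial G s
  refine ⟨G.arrowExp I J, ?_, fun s' m hm => ?_⟩
  · rw [hBs, coeff_sub, coeff_monomial, coeff_monomial, if_pos rfl, if_neg, sub_zero]
    intro h'
    exact h.arrowExp_ne G hG 0 (by rw [h'])
  · obtain ⟨I', J', h', hs', hBs'⟩ := hB.exists_monomial G s'
    rw [hBs', mul_sub, monomial_mul, monomial_mul, coeff_sub, coeff_monomial, coeff_monomial] at hm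
    apply Subtype.ext
    rw [hs, hs']
    by_cases h1 : m + G.arrowExp I' J' = G.arrowExp I J
    · obtain ⟨rfl, rfl⟩ := eq_of_arrowExp_le G hG h h' (h1 ▸ le_add_self)
      rfl
    · by_cases h2 : m + G.arrowExp J' I' = G.arrowExp I J
      · obtain ⟨rfl, rfl⟩ := eq_of_arrowExp_le G hG h h'.symm (h2 ▸ le_add_self)
        exact Sym2.eq_swap
      · rw [if_neg h1, if_neg h2, sub_zero] at hm
        exact absurd rfl hm

theorem Multigraph.IsSplitBinomials.injective (hG : G.IsSaturated) (hB : G.IsSplitBinomials B) :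
    Function.Injective B := by
  intro s s' h
  obtain ⟨a, ha, h'⟩ := hB.exists_coeff G hG s
  refine (h' s' 0 ?_).symm
  rw [← C_apply, C_1, one_mul, ← h, ha]
  exact one_ne_zero

theorem Multigraph.IsSplitBinomials.isMinimalGeneratingSet (hG : G.IsSaturated)
    (hB : G.IsSplitBinomials B) : IsMinimalGeneratingSet (Set.range B) (G.topplingIdeal K) := by
  refine ⟨hB.span_eq G hG, fun T hT hspan => ?_⟩
  obtain ⟨_, ⟨s, rfl⟩, hsT⟩ := Set.exists_of_ssubset hT
  obtain ⟨a, ha, h'⟩ := hB.exists_coeff G hG s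
  have hmem : B s ∈ Ideal.span T := by
    rw [hspan, ← hB.span_eq G hG]
    exact Ideal.subset_span ⟨s, rfl⟩
  have h0 : lcoeff K a (B s) = 0 := by
    refine linearMap_eq_zero_of_mem_span (lcoeff K a) (fun t ht m => ?_) hmem
    obtain ⟨s', rfl⟩ := hT.1 ht
    by_contra hne
    exact hsT (h' s' m hne ▸ ht)
  rw [lcoeff_apply, ha] at h0
  exact one_ne_zero h0

theorem leadingTerm_monomial_sub {σ : Type*} (ord : MonomialOrder σ) {a b : σ →₀ ℕ}
    (h : ord.toSyn b < ord.toSyn a) :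
    ord.leadingTerm (monomial a (1 : K) - monomial b 1) = monomial a 1 := by
  classical
  have hlt : ord.toSyn (ord.degree (monomial b (1 : K))) <
      ord.toSyn (ord.degree (monomial a (1 : K))) := by
    rwa [ord.degree_monomial, ord.degree_monomial, if_neg one_ne_zero, if_neg one_ne_zero]
  rw [MonomialOrder.leadingTerm, ord.degree_sub_of_lt hlt, ord.leadingCoeff_sub_of_lt hlt,
    ord.degree_monomial, if_neg one_ne_zero, ord.leadingCoeff_monomial]

theorem Multigraph.IsSplitBinomials.isGroebnerBasis (hG : G.IsSaturated)
    (hB : G.IsSplitBinomials B) (π : Equiv.Perm (Fin (n + 1))) :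
    IsGroebnerBasis (revLex π) (Set.range B) (G.topplingIdeal K) := by
  have hsub : Set.range B ⊆ G.topplingIdeal K := by
    rw [← hB.span_eq G hG]
    exact Ideal.subset_span
  refine ⟨hsub, le_antisymm (Ideal.span_mono (Set.image_mono hsub)) (Ideal.span_le.2 ?_)⟩
  rintro _ ⟨f, hf, rfl⟩
  by_cases hf0 : f = 0
  · rw [hf0, MonomialOrder.leadingTerm_zero]
    exact Ideal.zero_mem _
  -- The leading monomial shares its congruence class with another, hence smaller, monomial of `f`,
  -- so it is not the least of its fiber.
  obtain ⟨b, hb, hne, hcongr⟩ := exists_mem_support_latticeCongr hf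
    ((revLex π).degree_mem_support hf0)
  have hlt : (revLex π).toSyn b < (revLex π).toSyn ((revLex π).degree f) :=
    lt_of_le_of_ne ((revLex π).le_degree hb) fun h => hne ((revLex π).toSyn.injective h)
  obtain ⟨I, J, h, hq, hle⟩ := exists_split_le G π hG hcongr hlt
  have hmem : monomial (G.arrowExp I J) (1 : K) ∈
      Ideal.span ((revLex π).leadingTerm '' Set.range B) := by
    obtain ⟨s, hs⟩ := hB.eq_or_eq_neg G h
    have h1 := leadingTerm_monomial_sub (K := K) (revLex π) (arrowExp_lt G π hG h hq)
    have h2 : (revLex π).leadingTerm (B s) ∈ Ideal.span ((revLex π).leadingTerm '' Set.range B) :=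
      Ideal.subset_span ⟨_, ⟨s, rfl⟩, rfl⟩
    rcases hs with hs | hs
    · rwa [hs, h1] at h2
    · rw [hs, MonomialOrder.leadingTerm, MonomialOrder.degree_neg, MonomialOrder.leadingCoeff_neg,
        map_neg] at h2
      rw [MonomialOrder.leadingTerm] at h1
      rw [h1] at h2
      exact neg_mem_iff.1 h2
  obtain ⟨c, hc⟩ := exists_add_of_le hle
  have h3 : (revLex π).leadingTerm f =
      monomial c ((revLex π).leadingCoeff f) * monomial (G.arrowExp I J) 1 := by
    rw [MonomialOrder.leadingTerm, hc, monomial_mul, mul_one, add_comm c]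
  rw [SetLike.mem_coe, h3]
  exact Ideal.mul_mem_left _ _ hmem

theorem card_splits (n : ℕ) : Nat.card (splits n) = 2 ^ n - 1 := by
  classical
  -- A split is indexed by its side that avoids the last node, a non-empty subset of the other `n`
  -- nodes.
  let D : Finset (Finset (Fin (n + 1))) := ((Finset.univ.erase (Fin.last n)).powerset).erase ∅
  have hD : ∀ U, U ∈ D ↔ U.Nonempty ∧ Fin.last n ∉ U := fun U => by
    simp only [D, Finset.mem_erase, Finset.mem_powerset, Finset.nonempty_iff_ne_empty]
    refine and_congr_right fun _ => ⟨fun h hl => by simpa using h hl, fun h i hi => ?_⟩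
    simp only [Finset.mem_erase, Finset.mem_univ, and_true]
    rintro rfl
    exact h hi
  have hcard : D.card = 2 ^ n - 1 := by
    rw [Finset.card_erase_of_mem (Finset.empty_mem_powerset _), Finset.card_powerset,
      Finset.card_erase_of_mem (Finset.mem_univ _), Finset.card_univ, Fintype.card_fin,
      Nat.add_sub_cancel]
  rw [← hcard, ← Nat.card_eq_fintype_card.trans (Fintype.card_coe D)]
  symm
  refine Nat.card_congr (Equiv.ofBijective (fun U : D => (⟨s(U.1, U.1ᶜ), U.1, U.1ᶜ,
    isSplit_compl ((hD _).1 U.2).1 ⟨_, ((hD _).1 U.2).2⟩, rfl⟩ : splits n)) ⟨?_, ?_⟩)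
  · intro U U' h
    rcases Sym2.eq_iff.1 (congrArg Subtype.val h) with ⟨h1, -⟩ | ⟨h1, -⟩
    · exact Subtype.ext h1
    · have := ((hD _).1 U.2).2
      rw [h1, Finset.mem_compl, not_not] at this
      exact absurd this ((hD _).1 U'.2).2
  · rintro ⟨_, I, J, h, rfl⟩
    by_cases hl : Fin.last n ∈ I
    · refine ⟨⟨J, (hD _).2 ⟨h.2.1, fun hJ => (h.mem_iff _).1 hJ hl⟩⟩, Subtype.ext ?_⟩
      exact (congrArg (fun Z => s(J, Z)) h.symm.eq_compl.symm).trans Sym2.eq_swap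
    · refine ⟨⟨I, (hD _).2 ⟨h.1, hl⟩⟩, Subtype.ext ?_⟩
      exact congrArg (fun Z => s(I, Z)) h.eq_compl.symm

end SplitBinomials

/-! ### The minimal free resolution -/

section Resolution

variable {n : ℕ} (G : Multigraph n) (K : Type*) [Field K]

instance uniqueCycZero (n : ℕ) : Unique (Cyc n 0) where
  default := Cyc.mk ⟨fun _ => 0, fun j => ⟨0, Subsingleton.elim (α := Fin 1) _ _⟩⟩
  uniq c := by
    rw [← Cyc.mk_rep c]
    congr 1
    exact Subtype.ext (funext fun i => Subsingleton.elim (α := Fin 1) _ _)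

theorem augmentation_apply {R : Type*} [CommRing R] (I : Ideal R) (z : Cyc n 0 →₀ R) :
    Finsupp.linearCombination R (fun _ : Cyc n 0 => (1 : R ⧸ I)) z =
      Ideal.Quotient.mk I (z default) := by
  have h : z = Finsupp.single default (z default) := Finsupp.unique_single z
  conv_lhs => rw [h]
  rw [Finsupp.linearCombination_single, Algebra.smul_def, mul_one]
  rfl

theorem cycBoundary_zero_single (b : Cyc n 1) :
    G.cycBoundary K 0 (Finsupp.single b 1) = Finsupp.single default
      (G.arrow K (b.rep.block 0) (b.rep.block 1) - G.arrow K (b.rep.block 1) (b.rep.block 0)) := by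
  rw [Multigraph.cycBoundary, Finsupp.linearCombination_single, one_smul, Finsupp.single_sub,
    Fin.sum_univ_one]
  simp [Subsingleton.elim (α := Cyc n 0) _ default]

theorem isSplit_block (t : OrderedPartition n 1) : IsSplit (t.block 0) (t.block 1) := by
  have hne : ∀ s, (t.block s).Nonempty := fun s => by
    obtain ⟨i, hi⟩ := t.2 s
    exact ⟨i, by simpa [OrderedPartition.block] using hi⟩
  refine ⟨hne 0, hne 1, ?_, ?_⟩
  · rw [Finset.disjoint_left]
    intro i h0 h1
    simp only [OrderedPartition.block, Finset.mem_filter, Finset.mem_univ, true_and] at h0 h1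
    rw [h0] at h1
    exact absurd h1 (by decide)
  · ext i
    simp only [OrderedPartition.block, Finset.mem_union, Finset.mem_filter, Finset.mem_univ,
      true_and, iff_true]
    generalize t.1 i = x
    fin_cases x <;> simp

theorem IsSplit.exists_cyc {I J : Finset (Fin (n + 1))} (h : IsSplit I J)
    (hl : Fin.last n ∈ J) : ∃ b : Cyc n 1, b.rep.block 0 = I ∧ b.rep.block 1 = J := by
  classical
  let t : OrderedPartition n 1 := ⟨fun i => if i ∈ I then 0 else 1, fun s => by
    obtain ⟨i, hi⟩ := h.1
    obtain ⟨j, hj⟩ := h.2.1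
    fin_cases s
    · exact ⟨i, if_pos hi⟩
    · exact ⟨j, if_neg ((h.mem_iff j).1 hj)⟩⟩
  have ht : t.1 (Fin.last n) = Fin.last 1 := if_neg ((h.mem_iff _).1 hl)
  refine ⟨Cyc.mk t, ?_, ?_⟩
  · rw [rep_mk ht]
    ext i
    by_cases hi : i ∈ I <;> simp [OrderedPartition.block, t, hi]
  · rw [rep_mk ht]
    ext i
    by_cases hi : i ∈ I <;> simp [OrderedPartition.block, t, hi, h.mem_iff]

/-- In the lowest degree the differential has the split binomials as entries, so exactness there
says that they generate the ideal. -/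
theorem cycBoundary_exact_zero (hG : G.IsSaturated) :
    Function.Exact (G.cycBoundary K 0) (Finsupp.linearCombination (MvPolynomial (Fin (n + 1)) K)
      (fun _ : Cyc n 0 => (1 : MvPolynomial (Fin (n + 1)) K ⧸ G.topplingIdeal K))) := by
  intro z
  rw [augmentation_apply, Ideal.Quotient.eq_zero_iff_mem, topplingIdeal_eq_span G K hG]
  constructor
  · intro hz
    have hle : Ideal.span (G.splitBinomials K) ≤ Submodule.comap
        (Finsupp.lsingle (default : Cyc n 0)) (LinearMap.range (G.cycBoundary K 0)) := by
      have key : ∀ I J, IsSplit I J → Fin.last n ∈ J → Finsupp.single (default : Cyc n 0)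
          (monomial (G.arrowExp I J) (1 : K) - monomial (G.arrowExp J I) 1) ∈
            LinearMap.range (G.cycBoundary K 0) := by
        intro I J h hl
        obtain ⟨b, rfl, rfl⟩ := h.exists_cyc hl
        refine ⟨Finsupp.single b 1, ?_⟩
        rw [cycBoundary_zero_single, arrow_eq_monomial, arrow_eq_monomial]
      refine Ideal.span_le.2 ?_
      rintro _ ⟨_, ⟨I, J, h, rfl⟩, rfl⟩
      by_cases hl : Fin.last n ∈ J
      · exact key I J h hl
      · have := key J I h.symm ((h.symm.mem_iff _).2 hl)
        rw [← neg_mem_iff, ← Finsupp.single_neg, neg_sub] at this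
        exact this
    have h1 : z = Finsupp.single default (z default) := Finsupp.unique_single z
    have h2 : Finsupp.single default (z default) ∈ LinearMap.range (G.cycBoundary K 0) := hle hz
    rw [h1]
    exact h2
  · rintro ⟨y, rfl⟩
    induction y using Finsupp.induction_linear with
    | zero => simp
    | add y y' h h' => rw [map_add, Finsupp.add_apply]; exact Ideal.add_mem _ h h'
    | single b r =>
      have h1 : Finsupp.single b r = r • Finsupp.single b (1 : MvPolynomial (Fin (n + 1)) K) := by
        simp
      rw [h1, map_smul, cycBoundary_zero_single, Finsupp.smul_apply, Finsupp.single_eq_same,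
        arrow_eq_monomial, arrow_eq_monomial]
      exact Ideal.mul_mem_left _ _ (Ideal.subset_span (mem_splitBinomials G (isSplit_block b.rep)))

/-- Every matrix entry of the boundary map is a signed sum of monomials `x^g` that relate the
fiber of a cyclically ordered partition to the fiber of one of its faces. -/
theorem cycBoundary_entry_mem {k : ℕ} (b : Cyc n (k + 1)) (b' : Cyc n k)
    (A : AddSubgroup (MvPolynomial (Fin (n + 1)) K))
    (h : ∀ s s', s ≠ s' → ∀ j : Fin (k + 2),
      (∀ c, G.state b.rep.1 (j.succAbove c) =
        G.state b'.rep.1 c + G.arrowExp (b.rep.block s) (b.rep.block s')) →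
      monomial (G.arrowExp (b.rep.block s) (b.rep.block s')) 1 ∈ A) :
    G.cycBoundary K k (Finsupp.single b 1) b' ∈ A := by
  classical
  rw [Multigraph.cycBoundary, Finsupp.linearCombination_single, one_smul, Finsupp.sub_apply,
    Finsupp.finsetSum_apply]
  simp only [arrow_eq_monomial, Finsupp.single_apply]
  refine A.sub_mem (A.sum_mem fun s _ => ?_) ?_
  · split_ifs with hb
    · subst hb
      have hmem := h s.castSucc s.succ (Fin.castSucc_lt_succ).ne s.succ (fun c => by
        rw [rep_mk (merge_last b.rep_last s)]
        exact state_merge G b.rep s c)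
      rcases neg_one_pow_eq_or (MvPolynomial (Fin (n + 1)) K) (s : ℕ) with h1 | h1
      · rwa [h1, one_mul]
      · rw [h1, neg_one_mul]
        exact A.neg_mem hmem
    · exact A.zero_mem
  · split_ifs with hb
    · subst hb
      exact h (Fin.last (k + 1)) 0 (Fin.last_pos).ne' 0 (fun c => by
        rw [rep_mk (mergeEnds_last b.rep_last), Fin.zero_succAbove]
        exact state_mergeEnds G b.rep c)
    · exact A.zero_mem

/-- The class of the fiber of a cyclically ordered partition. -/
noncomputable def Multigraph.cycDegree (k : ℕ) (b : Cyc n k) : (Fin (n + 1) → ℤ) ⧸ G.lattice :=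
  G.lattice.mkQ fun i => (G.outflow b.rep.1 i : ℤ)

theorem mkQ_eq_of_latticeCongr {a b : Fin (n + 1) →₀ ℕ} (h : LatticeCongr G.lattice a b) :
    G.lattice.mkQ (fun i => (a i : ℤ)) = G.lattice.mkQ fun i => (b i : ℤ) :=
  (Submodule.Quotient.eq _).2 h

theorem cycBoundary_graded {k : ℕ} (b : Cyc n (k + 1)) (b' : Cyc n k) (a : Fin (n + 1) →₀ ℕ)
    (ha : a ∈ (G.cycBoundary K k (Finsupp.single b 1) b').support) :
    G.cycDegree (k + 1) b = G.lattice.mkQ (fun i => (a i : ℤ)) + G.cycDegree k b' := by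
  -- The polynomials supported in the required degree form an additive subgroup, so homogeneity need
  -- only be checked on single monomials, where it compares one state of `b` with one of `b'`.
  have h := cycBoundary_entry_mem G K b b' (restrictSupport K {a | G.cycDegree (k + 1) b =
    G.lattice.mkQ (fun i => (a i : ℤ)) + G.cycDegree k b'}).toAddSubgroup (by
    intro s s' _ j hj
    rw [Submodule.mem_toAddSubgroup, mem_restrictSupport_iff]
    refine (Finset.coe_subset.2 support_monomial_subset).trans ?_
    rw [Finset.coe_singleton, Set.singleton_subset_iff, Set.mem_ofPred_eq, Multigraph.cycDegree,
      Multigraph.cycDegree, mkQ_eq_of_latticeCongr G (state_latticeCongr G b.rep.1 (j.succAbove 0)),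
      mkQ_eq_of_latticeCongr G (state_latticeCongr G b'.rep.1 0), hj, ← map_add]
    congr 1
    funext i
    simp [add_comm])
  exact h ha

theorem cycBoundary_minimal (hG : G.IsSaturated) {k : ℕ} (b : Cyc n (k + 1)) (b' : Cyc n k) :
    G.cycBoundary K k (Finsupp.single b 1) b' ∈
      Ideal.span (Set.range (X : Fin (n + 1) → MvPolynomial (Fin (n + 1)) K)) := by
  refine cycBoundary_entry_mem G K b b'
    (Submodule.toAddSubgroup (Ideal.span (Set.range X))) fun s s' hs j _ => ?_
  obtain ⟨i, hi⟩ := b.rep.2 s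
  obtain ⟨i', hi'⟩ := b.rep.2 s'
  have hpos := arrowExp_pos G hG (I := b.rep.block s) (J := b.rep.block s') (i := i) (j := i')
    (by simpa [OrderedPartition.block] using hi) (by simpa [OrderedPartition.block] using hi')
    (fun h => hs (by rw [← hi, ← hi', h]))
  exact Ideal.mem_of_dvd _ (X_dvd_monomial.2 (Or.inr hpos.ne')) (Ideal.subset_span ⟨i, rfl⟩)

theorem cyc_isMinimalFreeResolution (hG : G.IsSaturated) :
    IsMinimalFreeResolution G.lattice (G.topplingIdeal K) (Cyc n) (G.cycBoundary K) where
  finite k := Finite.of_injective (Cyc.rep (n := n) (k := k)) fun c c' h => by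
    rw [← Cyc.mk_rep c, h, Cyc.mk_rep]
  bounded := ⟨n, fun _ h => Cyc.isEmpty_of_lt h⟩
  surjective x := by
    obtain ⟨f, rfl⟩ := Ideal.Quotient.mk_surjective x
    exact ⟨Finsupp.single default f, by rw [augmentation_apply, Finsupp.single_eq_same]⟩
  exact_zero := cycBoundary_exact_zero G K hG
  exact_succ k := (coincidesVia G K hG (revLex 1)).exact k (scarf_exact G K hG k)
  graded := by
    refine ⟨G.cycDegree, fun b => ?_, fun k b b' a ha => cycBoundary_graded G K b b' a ha⟩
    rw [Multigraph.cycDegree, ← map_zero G.lattice.mkQ]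
    congr 1
    funext i
    rw [outflow_apply]
    exact Finset.sum_eq_zero fun j _ => by
      rw [ind_neg (by rw [Subsingleton.elim (α := Fin 1) (b.rep.1 i) (b.rep.1 j)]; exact lt_irrefl _),
        mul_zero]
  minimal k b b' := cycBoundary_minimal G K hG b b'

end Resolution

end ChipFiring

theorem mainTheorem1 {K : Type*} [Field K] {n : ℕ} (G : Multigraph n) (hG : G.IsSaturated) :
    IsGenericLatticeIdeal (G.topplingIdeal K) ∧
    Nat.card (splits n) = 2 ^ n - 1 ∧
    (∀ B : splits n → MvPolynomial (Fin (n + 1)) K, G.IsSplitBinomials B →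
      Function.Injective B ∧
      IsMinimalGeneratingSet (Set.range B) (G.topplingIdeal K) ∧
      ∀ π : Equiv.Perm (Fin (n + 1)),
        IsGroebnerBasis (revLex π) (Set.range B) (G.topplingIdeal K)) ∧
    (∃ e : ∀ k, Cyc n k ≃ BasicFiber G.lattice (k + 1),
      ∀ ord : MonomialOrder.{0, 0} (Fin (n + 1)),
        CoincidesVia e (G.cycBoundary K) (scarfBoundary K G.lattice ord)) ∧
    IsMinimalFreeResolution G.lattice (G.topplingIdeal K) (Cyc n) (G.cycBoundary K) := by
  exact ⟨isGenericLatticeIdeal G K hG, card_splits n,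
    fun B hB => ⟨hB.injective G hG, hB.isMinimalGeneratingSet G hG, hB.isGroebnerBasis G hG⟩,
    ⟨G.cycEquiv hG, coincidesVia G K hG⟩, cyc_isMinimalFreeResolution G K hG⟩
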